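/- Let $d\ge 2$ and let $X=\mathbb H^d/\Gamma$, where $\Gamma$ is a discrete subgroup of the isometry group of hyperbolic space $\mathbb H^d$ such that $\operatorname{vol}X<\infty$. Let $-\Delta\ge 0$ be the Laplace–Beltrami operator on $L^2(X)$ and $\psi_0=(\operatorname{vol}X)^{-1/2}\mathbf 1_X$ the normalized constant function. Assume that there is $\Xi>0$ with $-\Delta(\mathrm{Id}-|\psi_0\rangle\langle\psi_0|)\ge\Xi$ on $\psi_0^\perp$, i.e. $\langle u,-\Delta u\rangle\ge\Xi\|u\|^2$ for all $u$ in the domain of $-\Delta$ with $u\perp\psi_0$. Let $\mu>0$, let $V:[0,\infty)\to[0,\infty)$ be measurable and essentially bounded with $V=0$ outside $[0,R_0]$ for some $R_0>0$, and for $N\ge 1$ consider, on the Hilbert space of permutation-symmetric functions in $L^2(X^N)$, the Hamiltonian \[ H_N=-\mu\sum_{i=1}^N\Delta_i+\sum_{1\le i<j\le N}V(d(x_i,x_j)), \] where $d(\cdot,\cdot)$ is the distance on $X$ and the domain of $H_N$ consists of the symmetric functions in the domain of $\sum_i\Delta_i$. Let $E_N=\inf\sigma(H_N)$ and let $\Psi_0$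 be a normalized ground state, $\|\Psi_0\|=1$, $H_N\Psi_0=E_N\Psi_0$. Then the one-particle density matrix $\gamma$ of $\Psi_0$, the operator with integral kernel \[ \gamma(x,x')=\int_{X^{N-1}}\Psi_0(x,\mathbf x)\,\overline{\Psi_0(x',\mathbf x)}\,d\mathbf x , \] is bounded on $L^2(X)$ and satisfies \[ \langle\psi_0,\gamma\psi_0\rangle\ \ge\ 1-\frac{E_N}{N\mu\,\Xi}. \] In particular, for $\mu=1$, $\langle\psi_0,\gamma\psi_0\rangle\ge 1-\frac{E_N}{N\,\Xi}$. -/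

import Mathlib

open MeasureTheory Filter Topology
open scoped ContDiff ComplexConjugate

noncomputable section

namespace HypBose

/-! ### Hyperbolic space, hyperboloid model -/

/-- The Lorentzian bilinear form `v₀ w₀ - v₁ w₁ - … - v_d w_d` on `ℝ^(d+1)`. -/
def lorentz {d : ℕ} (v w : Fin (d + 1) → ℝ) : ℝ :=
  v 0 * w 0 - ∑ i : Fin d, v i.succ * w i.succ

/-- `d`-dimensional hyperbolic space: the upper sheet of the hyperboloid `q_d = 1`. -/
abbrev Hyp (d : ℕ) : Type :=
  {z : Fin (d + 1) → ℝ // 0 < z 0 ∧ lorentz z z = 1}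

/-- The hyperbolic distance, `cosh d(z, w) = ⟨z, w⟩` for the Lorentzian form. -/
def hypDist {d : ℕ} (z w : Hyp d) : ℝ := Real.arcosh (lorentz z.1 w.1)

theorem chartAux {d : ℕ} (y : EuclideanSpace ℝ (Fin d)) :
    0 < (Fin.cons (√(1 + ‖y‖ ^ 2)) (fun i => y i) : Fin (d + 1) → ℝ) 0 ∧
      lorentz (Fin.cons (√(1 + ‖y‖ ^ 2)) (fun i => y i) : Fin (d + 1) → ℝ)
        (Fin.cons (√(1 + ‖y‖ ^ 2)) (fun i => y i)) = 1 := by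
  have h : 0 < 1 + ‖y‖ ^ 2 := by positivity
  refine ⟨by simpa using Real.sqrt_pos.mpr h, ?_⟩
  simp only [lorentz, Fin.cons_zero, Fin.cons_succ]
  rw [Real.mul_self_sqrt h.le, EuclideanSpace.real_norm_sq_eq]
  simp [pow_two]

/-- The global chart `ℝ^d ≃ H^d`, `y ↦ (√(1 + |y|²), y)`. -/
def chart {d : ℕ} (y : EuclideanSpace ℝ (Fin d)) : Hyp d :=
  ⟨Fin.cons (√(1 + ‖y‖ ^ 2)) (fun i => y i), chartAux y⟩

/-- The inverse of `chart`: forget the zeroth coordinate. -/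
def coords {d : ℕ} (z : Hyp d) : EuclideanSpace ℝ (Fin d) :=
  WithLp.toLp 2 (fun i : Fin d => z.1 i.succ)

/-- The `i`-th tangent vector `∂ᵢ chart` in `ℝ^(d+1)`. -/
def chartTangent {d : ℕ} (y : EuclideanSpace ℝ (Fin d)) (i : Fin d) : Fin (d + 1) → ℝ :=
  fderiv ℝ (fun y' : EuclideanSpace ℝ (Fin d) => (chart y').1) y (EuclideanSpace.single i 1)

/-- The hyperbolic metric tensor `g_ij` in the global chart: the pullback of the Lorentzian metric
`-dz₀² + dz₁² + … + dz_d²`. -/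
def metricTensor {d : ℕ} (y : EuclideanSpace ℝ (Fin d)) : Matrix (Fin d) (Fin d) ℝ :=
  Matrix.of fun i j => -lorentz (chartTangent y i) (chartTangent y j)

/-- The Riemannian volume `√(det g) dy` on `H^d`. -/
def hypVolume (d : ℕ) : Measure (Hyp d) :=
  ((volume : Measure (EuclideanSpace ℝ (Fin d))).withDensity
    fun y => ENNReal.ofReal √(metricTensor y).det).map chart

/-- The partial derivative `∂ᵢ f` in the global chart. -/
def partialD {d : ℕ} (f : Hyp d → ℂ) (i : Fin d) (z : Hyp d) : ℂ :=
  fderiv ℝ (fun y : EuclideanSpace ℝ (Fin d) => f (chart y)) (coords z) (EuclideanSpace.single i 1)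

/-- The pointwise Riemannian inner product `⟨∇f, ∇h⟩ = ∑ gⁱʲ (∂ᵢ f)⁻ ∂ⱼ h`. -/
def gradInner {d : ℕ} (f h : Hyp d → ℂ) (z : Hyp d) : ℂ :=
  ∑ i : Fin d, ∑ j : Fin d,
    (((metricTensor (coords z))⁻¹ i j : ℝ) : ℂ) * (conj (partialD f i z) * partialD h j z)

/-- The isometry group `Iso(H^d)`, realised as the group of Lorentz transformations that preserve
the upper sheet, with the topology of matrices. -/
def Iso (d : ℕ) : Subgroup (GL (Fin (d + 1)) ℝ) where
  carrier := {A | (∀ v w : Fin (d + 1) → ℝ, lorentz (A.1.mulVec v) (A.1.mulVec w) = lorentz v w) ∧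
    ∀ z : Hyp d, 0 < A.1.mulVec z.1 0}
  one_mem' := by
    refine ⟨fun v w => by simp, fun z => by simpa using z.2.1⟩
  mul_mem' := by
    rintro A B ⟨hA, hA'⟩ ⟨hB, hB'⟩
    refine ⟨fun v w => ?_, fun z => ?_⟩
    · rw [Units.val_mul, ← Matrix.mulVec_mulVec, ← Matrix.mulVec_mulVec, hA, hB]
    · rw [Units.val_mul, ← Matrix.mulVec_mulVec]
      exact hA' ⟨B.1.mulVec z.1, hB' z, by rw [hB]; exact z.2.2⟩
  inv_mem' := by
    rintro A ⟨hA, hA'⟩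
    have key : ∀ v : Fin (d + 1) → ℝ, A.1.mulVec ((A⁻¹).1.mulVec v) = v := fun v => by
      rw [Matrix.mulVec_mulVec, ← Units.val_mul]; simp
    have hinv : ∀ v w : Fin (d + 1) → ℝ,
        lorentz ((A⁻¹).1.mulVec v) ((A⁻¹).1.mulVec w) = lorentz v w := fun v w => by
      rw [← hA, key, key]
    refine ⟨hinv, fun z => ?_⟩
    have h1 : lorentz ((A⁻¹).1.mulVec z.1) ((A⁻¹).1.mulVec z.1) = 1 := by
      rw [hinv]; exact z.2.2
    by_contra hneg
    rcases (not_lt.mp hneg).lt_or_eq with h | h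
    · have h2 := hA' ⟨-(A⁻¹).1.mulVec z.1, by simpa using h, by simpa [lorentz] using h1⟩
      rw [Matrix.mulVec_neg, key] at h2
      have h3 := z.2.1
      simp only [Pi.neg_apply] at h2
      linarith
    · simp only [lorentz, h] at h1
      have h4 : 0 ≤ ∑ i : Fin d, (A⁻¹).1.mulVec z.1 i.succ * (A⁻¹).1.mulVec z.1 i.succ :=
        Finset.sum_nonneg fun i _ => mul_self_nonneg _
      linarith

instance isoAction (d : ℕ) : MulAction (Iso d) (Hyp d) where
  smul A z := ⟨A.1.1.mulVec z.1, A.2.2 z, by rw [A.2.1]; exact z.2.2⟩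
  one_smul z := Subtype.ext (by
    change (1 : Matrix (Fin (d + 1)) (Fin (d + 1)) ℝ).mulVec z.1 = z.1
    simp)
  mul_smul A B z := Subtype.ext (by
    change (A.1.1 * B.1.1).mulVec z.1 = A.1.1.mulVec (B.1.1.mulVec z.1)
    rw [Matrix.mulVec_mulVec])

/-! ### The quotient `X = H^d / Γ` -/

/-- The quotient `X = H^d / Γ`. -/
abbrev HypQuot {d : ℕ} (Γ : Subgroup (Iso d)) : Type :=
  Quotient (MulAction.orbitRel Γ (Hyp d))

/-- The projection `H^d → X`. -/
def proj {d : ℕ} (Γ : Subgroup (Iso d)) (z : Hyp d) : HypQuot Γ := Quotient.mk _ z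

/-- A fundamental domain: the points that come first in their `Γ`-orbit for the lexicographic order
of `ℝ^(d+1)`. As `z₀ = cosh d(z, (1, 0, …, 0))`, this is a Dirichlet domain with ties on
its boundary resolved; for discrete `Γ` it contains exactly one point of each orbit. -/
def fundDomain {d : ℕ} (Γ : Subgroup (Iso d)) : Set (Hyp d) :=
  {z | ∀ g : Γ, toLex z.1 ≤ toLex (g • z).1}

/-- The volume restricted to the fundamental domain. The integral over `X` of a `Γ`-invariant
function on `H^d` is its integral against this measure. -/
def fundVolume {d : ℕ} (Γ : Subgroup (Iso d)) : Measure (Hyp d) :=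
  (hypVolume d).restrict (fundDomain Γ)

/-- The Riemannian volume on `X`. -/
def volX {d : ℕ} (Γ : Subgroup (Iso d)) : Measure (HypQuot Γ) :=
  (fundVolume Γ).map (proj Γ)

/-- The distance function on `X`: the least distance between lifts. -/
def distX {d : ℕ} (Γ : Subgroup (Iso d)) (x x' : HypQuot Γ) : ℝ :=
  sInf {r | ∃ z w : Hyp d, proj Γ z = x ∧ proj Γ w = x' ∧ r = hypDist z w}

/-- The volume on `X^N`. -/
def volXN {d : ℕ} (Γ : Subgroup (Iso d)) (N : ℕ) : Measure (Fin N → HypQuot Γ) :=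
  Measure.pi fun _ => volX Γ

/-- `L²(X)`. -/
abbrev L2X {d : ℕ} (Γ : Subgroup (Iso d)) : Type := Lp ℂ 2 (volX Γ)

/-- `L²(X^N)`. -/
abbrev L2XN {d : ℕ} (Γ : Subgroup (Iso d)) (N : ℕ) : Type := Lp ℂ 2 (volXN Γ N)

/-! ### Operators

An unbounded operator on a space `E` is represented by its graph, a subset of `E × E`. -/

/-- The graph of the operator associated with a nonnegative quadratic form `q` on a space `core` of
functions on `Y`. The function `u` lies in the closed form domain if it is an `L²`-limit of elements
`φ k` of `core` that form a Cauchy sequence for `q`; it lies in the domain of the operator, with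
value `v`, if moreover `q(ψ, u) = lim q(ψ, φ k) = ⟨ψ, v⟩` for all `ψ` in `core`. -/
def formOperator {Y : Type*} [MeasurableSpace Y] (m : Measure Y) (core : Set (Y → ℂ))
    (q : (Y → ℂ) → (Y → ℂ) → ℂ) : Set (Lp ℂ 2 m × Lp ℂ 2 m) :=
  {p | ∃ φ : ℕ → Y → ℂ, (∀ k, φ k ∈ core) ∧
    Tendsto (fun k => eLpNorm (φ k - (p.1 : Y → ℂ)) 2 m) atTop (𝓝 0) ∧
    Tendsto (fun kl : ℕ × ℕ => q (φ kl.1 - φ kl.2) (φ kl.1 - φ kl.2)) atTop (𝓝 0) ∧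
    ∀ ψ ∈ core, Tendsto (fun k => q ψ (φ k)) atTop (𝓝 (∫ y, conj (ψ y) * p.2 y ∂m))}

/-- The spectrum of the operator with graph `A`: all `z` such that `A - z` has no everywhere defined
bounded inverse `R`. -/
def opSpectrum {E : Type*} [NormedAddCommGroup E] [NormedSpace ℂ E] (A : Set (E × E)) : Set ℂ :=
  {z | ¬ ∃ R : E →L[ℂ] E, ∀ u v : E, (u, v) ∈ A ↔ R (v - z • u) = u}

/-! ### The Laplacian on `X` and on `X^N`

`-Δ` is the self-adjoint operator of the Dirichlet form `∫ |∇φ|²` on `H¹`, where `H¹` is the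
completion of the smooth functions with `φ, ∇φ ∈ L²`. Functions are smooth on `X^N` if their lifts
to `(H^d)^N` are. -/

/-- Smooth functions `φ` on `X` with `φ, ∇φ ∈ L²(X)`. -/
def smoothX {d : ℕ} (Γ : Subgroup (Iso d)) : Set (HypQuot Γ → ℂ) :=
  {φ | ContDiff ℝ ∞ (fun y : EuclideanSpace ℝ (Fin d) => φ (proj Γ (chart y))) ∧
    MemLp φ 2 (volX Γ) ∧
    Integrable (fun z => gradInner (φ ∘ proj Γ) (φ ∘ proj Γ) z) (fundVolume Γ)}

/-- The Dirichlet form `∫_X ⟨∇ψ, ∇φ⟩`. -/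
def energyX {d : ℕ} (Γ : Subgroup (Iso d)) (ψ φ : HypQuot Γ → ℂ) : ℂ :=
  ∫ z, gradInner (ψ ∘ proj Γ) (φ ∘ proj Γ) z ∂(fundVolume Γ)

/-- The (graph of the) Laplace-Beltrami operator `-Δ` on `L²(X)`. -/
def laplaceX {d : ℕ} (Γ : Subgroup (Iso d)) : Set (L2X Γ × L2X Γ) :=
  formOperator (volX Γ) (smoothX Γ) (energyX Γ)

/-- The lift to `(H^d)^N` of a function on `X^N`, as a function of its `i`-th variable only, the
other variables being those of `z`. -/
def liftSlice {d : ℕ} (Γ : Subgroup (Iso d)) {N : ℕ} (φ : (Fin N → HypQuot Γ) → ℂ) (i : Fin N)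
    (z : Fin N → Hyp d) : Hyp d → ℂ :=
  fun t => φ (fun j => proj Γ (Function.update z i t j))

/-- The lift of `⟨∇ᵢ ψ, ∇ᵢ φ⟩`, where `∇ᵢ` is the gradient in the `i`-th variable. -/
def gradInnerN {d : ℕ} (Γ : Subgroup (Iso d)) {N : ℕ} (ψ φ : (Fin N → HypQuot Γ) → ℂ) (i : Fin N)
    (z : Fin N → Hyp d) : ℂ :=
  gradInner (liftSlice Γ ψ i z) (liftSlice Γ φ i z) (z i)

/-- Smooth functions `φ` on `X^N` with `φ, ∇φ ∈ L²(X^N)`. -/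
def smoothXN {d : ℕ} (Γ : Subgroup (Iso d)) (N : ℕ) : Set ((Fin N → HypQuot Γ) → ℂ) :=
  {φ | ContDiff ℝ ∞ (fun y : Fin N → EuclideanSpace ℝ (Fin d) => φ fun i => proj Γ (chart (y i))) ∧
    MemLp φ 2 (volXN Γ N) ∧
    ∀ i : Fin N, Integrable (gradInnerN Γ φ φ i) (Measure.pi fun _ : Fin N => fundVolume Γ)}

/-- The Dirichlet form `∑ᵢ ∫_{X^N} ⟨∇ᵢ ψ, ∇ᵢ φ⟩`. -/
def energyXN {d : ℕ} (Γ : Subgroup (Iso d)) (N : ℕ) (ψ φ : (Fin N → HypQuot Γ) → ℂ) : ℂ :=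
  ∑ i : Fin N, ∫ z, gradInnerN Γ ψ φ i z ∂(Measure.pi fun _ : Fin N => fundVolume Γ)

/-- The (graph of the) operator `-∑ᵢ Δᵢ` on `L²(X^N)`. -/
def laplaceXN {d : ℕ} (Γ : Subgroup (Iso d)) (N : ℕ) : Set (L2XN Γ N × L2XN Γ N) :=
  formOperator (volXN Γ N) (smoothXN Γ N) (energyXN Γ N)

/-! ### The Bose gas -/

theorem permQuasi {d : ℕ} (Γ : Subgroup (Iso d)) [IsFiniteMeasure (volX Γ)] (N : ℕ)
    (σ : Equiv.Perm (Fin N)) :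
    Measure.QuasiMeasurePreserving (fun x : Fin N → HypQuot Γ => x ∘ σ)
      (volXN Γ N) (volXN Γ N) := by
  have h := (measurePreserving_piCongrLeft (fun _ : Fin N => volX Γ) σ.symm).quasiMeasurePreserving
  have he : (fun x : Fin N → HypQuot Γ => x ∘ σ) =
      MeasurableEquiv.piCongrLeft (fun _ : Fin N => HypQuot Γ) σ.symm := by
    funext x
    funext j
    obtain ⟨k, rfl⟩ := σ.symm.surjective j
    rw [MeasurableEquiv.coe_piCongrLeft, Equiv.piCongrLeft_apply_apply]
    simp
  rw [he]
  exact h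

/-- The Hilbert space of `N` bosons: the permutation invariant elements of `L²(X^N)`. -/
def bosonic {d : ℕ} (Γ : Subgroup (Iso d)) [IsFiniteMeasure (volX Γ)] (N : ℕ) :
    Submodule ℂ (L2XN Γ N) where
  carrier := {Ψ | ∀ σ : Equiv.Perm (Fin N), (fun x => Ψ (x ∘ σ)) =ᵐ[volXN Γ N] Ψ}
  zero_mem' := by
    intro σ
    have h := Lp.coeFn_zero ℂ 2 (volXN Γ N)
    exact ((permQuasi Γ N σ).ae_eq_comp h).trans h.symm
  add_mem' := by
    intro Ψ Φ hΨ hΦ σ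
    have h := Lp.coeFn_add Ψ Φ
    refine ((permQuasi Γ N σ).ae_eq_comp h).trans (EventuallyEq.trans ?_ h.symm)
    exact (hΨ σ).add (hΦ σ)
  smul_mem' := by
    intro c Ψ hΨ σ
    have h := Lp.coeFn_smul c Ψ
    refine ((permQuasi Γ N σ).ae_eq_comp h).trans (EventuallyEq.trans ?_ h.symm)
    exact (hΨ σ).const_smul c

/-- The (graph of the) Hamiltonian `H_N = -μ ∑ᵢ Δᵢ + ∑_{i < j} V(d(xᵢ, xⱼ))` on the bosonic
Hilbert space; its domain consists of the bosonic functions in the domain of `-∑ᵢ Δᵢ`. -/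
def hamiltonian {d : ℕ} (Γ : Subgroup (Iso d)) [IsFiniteMeasure (volX Γ)] (N : ℕ) (μ : ℝ)
    (V : ℝ → ℝ) : Set (bosonic Γ N × bosonic Γ N) :=
  {p | ∃ η : L2XN Γ N, ((p.1 : L2XN Γ N), η) ∈ laplaceXN Γ N ∧
    ((p.2 : L2XN Γ N) : (Fin N → HypQuot Γ) → ℂ) =ᵐ[volXN Γ N] fun x =>
      (μ : ℂ) * η x +
        ((∑ i : Fin N, ∑ j ∈ Finset.Ioi i, V (distX Γ (x i) (x j)) : ℝ) : ℂ) *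
          (p.1 : L2XN Γ N) x}

/-- The ground state energy `E_N = inf σ(H_N)`. -/
def groundEnergy {d : ℕ} (Γ : Subgroup (Iso d)) [IsFiniteMeasure (volX Γ)] (N : ℕ) (μ : ℝ)
    (V : ℝ → ℝ) : ℝ :=
  sInf {t : ℝ | (t : ℂ) ∈ opSpectrum (hamiltonian Γ N μ V)}

/-- `Ψ` is a normalized ground state: `‖Ψ‖ = 1` and `H_N Ψ = E_N Ψ`. -/
def IsGroundState {d : ℕ} (Γ : Subgroup (Iso d)) [IsFiniteMeasure (volX Γ)] (N : ℕ) (μ : ℝ)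
    (V : ℝ → ℝ) (Ψ : bosonic Γ N) : Prop :=
  ‖Ψ‖ = 1 ∧ (Ψ, (groundEnergy Γ N μ V : ℂ) • Ψ) ∈ hamiltonian Γ N μ V

/-- The kernel `γ(x, x') = ∫ Ψ(x, 𝐱) conj Ψ(x', 𝐱) d𝐱` of the one-particle density matrix of a
state of `n + 1` particles. -/
def densityKernel {d : ℕ} (Γ : Subgroup (Iso d)) {n : ℕ} (Ψ : L2XN Γ (n + 1))
    (x x' : HypQuot Γ) : ℂ :=
  ∫ xs : Fin n → HypQuot Γ,
    Ψ (Fin.cons (α := fun _ => HypQuot Γ) x xs) *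
      conj (Ψ (Fin.cons (α := fun _ => HypQuot Γ) x' xs)) ∂(volXN Γ n)

/-- `γ` is the one-particle density matrix of `Ψ`: the bounded operator on `L²(X)` with kernel
`densityKernel Γ Ψ`. -/
def IsDensityMatrix {d : ℕ} (Γ : Subgroup (Iso d)) {n : ℕ} (Ψ : L2XN Γ (n + 1))
    (γ : L2X Γ →L[ℂ] L2X Γ) : Prop :=
  ∀ f : L2X Γ, γ f =ᵐ[volX Γ] fun x => ∫ x', densityKernel Γ Ψ x x' * f x' ∂(volX Γ)

/-- The normalized constant function `ψ₀ = vol(X)^(-1/2)` in `L²(X)`. -/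
def constState {d : ℕ} (Γ : Subgroup (Iso d)) [IsFiniteMeasure (volX Γ)] : L2X Γ :=
  Lp.const 2 (volX Γ) (((√((volX Γ).real Set.univ))⁻¹ : ℝ) : ℂ)

/-- `-Δ (1 - |ψ₀⟩⟨ψ₀|) ≥ Ξ`, that is, `⟨u, -Δ u⟩ ≥ Ξ ‖u‖²` for all `u` in the domain of `-Δ` that
are orthogonal to the constants. -/
def HasSpectralGap {d : ℕ} (Γ : Subgroup (Iso d)) [IsFiniteMeasure (volX Γ)] (Ξ : ℝ) : Prop :=
  ∀ u v : L2X Γ, (u, v) ∈ laplaceX Γ → inner ℂ (constState Γ) u = 0 →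
    Ξ * ‖u‖ ^ 2 ≤ (inner ℂ u v).re

end HypBose

end

/-! Since `V ≥ 0`, the energy of `Ψ₀` is at least `μ⟨Ψ₀, -∑ᵢ Δᵢ Ψ₀⟩`. In each variable the spectral
gap gives `-Δᵢ ≥ Ξ(1 - Pᵢ)`, where `Pᵢ` projects onto the functions constant in `xᵢ`. By bosonic
symmetry all `‖PᵢΨ₀‖²` agree, and `‖P₀Ψ₀‖² = ⟨ψ₀, γψ₀⟩` by Fubini. Hence `E_N ≥ NμΞ(1 - ⟨ψ₀, γψ₀⟩)`.

The work lies in `-Δᵢ ≥ Ξ(1 - Pᵢ)`. The gap is assumed on the operator domain of `-Δ` on `X`,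
whereas slices of smooth functions on `X^N` only lie in the form core. Both Dirichlet forms are
written as `⟨Dψ, Dφ⟩` with `D` a gradient into a Hilbert space. `exists_mem_formOperator`
approximates core functions by resolvents, so that `gap_of_formOperator` and
`poincare_of_formOperator` yield a Poincaré inequality on the core. `poincare_coreXN` integrates it
over the remaining variables, and `kinetic_lower_bound` passes from the core of `X^N` to the
operator domain. On the other side, `exists_isDensityMatrix` realises `γ` as a Hilbert–Schmidt
operator and computes its expectation in `ψ₀`. -/

noncomputable section

namespace HypBose

/-! ### Operators of forms `q(ψ, φ) = ⟨D ψ, D φ⟩` -/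

section FormOperator

variable {Y H : Type*} [MeasurableSpace Y] {m : Measure Y} [NormedAddCommGroup H]
  [InnerProductSpace ℂ H]

/-- The map from a space of square integrable functions to `L²`. -/
def toL2 (core : Submodule ℂ (Y → ℂ)) (hL : ∀ φ ∈ core, MemLp φ 2 m) : core →ₗ[ℂ] Lp ℂ 2 m where
  toFun φ := (hL φ φ.2).toLp φ
  map_add' φ ψ := (hL φ φ.2).toLp_add (hL ψ ψ.2)
  map_smul' c φ := (hL φ φ.2).toLp_const_smul c

variable {core : Submodule ℂ (Y → ℂ)} {hL : ∀ φ ∈ core, MemLp φ 2 m}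

theorem coeFn_toL2 (φ : core) : toL2 core hL φ =ᵐ[m] φ := (hL φ φ.2).coeFn_toLp

theorem inner_toL2 (ψ : core) (v : Lp ℂ 2 m) :
    inner ℂ (toL2 core hL ψ) v = ∫ y, conj ((ψ : Y → ℂ) y) * v y ∂m := by
  rw [L2.inner_def]
  refine integral_congr_ae ?_
  filter_upwards [coeFn_toL2 (hL := hL) ψ] with y hy
  rw [hy, RCLike.inner_apply, mul_comm]

theorem tendsto_toL2_iff (φ : ℕ → core) (u : Lp ℂ 2 m) :
    Tendsto (fun k => toL2 core hL (φ k)) atTop (𝓝 u) ↔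
      Tendsto (fun k => eLpNorm ((φ k : Y → ℂ) - (u : Y → ℂ)) 2 m) atTop (𝓝 0) := by
  rw [Lp.tendsto_Lp_iff_tendsto_eLpNorm']
  refine tendsto_congr fun k => eLpNorm_congr_ae ?_
  exact (coeFn_toL2 (φ k)).sub (EventuallyEq.refl _ _)

variable {q : (Y → ℂ) → (Y → ℂ) → ℂ} {D : core →ₗ[ℂ] H}

/-- The hypotheses say that `(w, g)` lies in the closure of the graph of `D` and that `D* g = v`
when tested on the core. No closability of `D` is required. -/
theorem mem_formOperator (hq : ∀ ψ φ : core, q ψ φ = inner ℂ (D ψ) (D φ)) {w v : Lp ℂ 2 m}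
    {g : H} (φ : ℕ → core) (hφ : Tendsto (fun k => toL2 core hL (φ k)) atTop (𝓝 w))
    (hD : Tendsto (fun k => D (φ k)) atTop (𝓝 g))
    (hv : ∀ ψ, inner ℂ (D ψ) g = inner ℂ (toL2 core hL ψ) v) :
    (w, v) ∈ formOperator m (core : Set (Y → ℂ)) q := by
  refine ⟨fun k => φ k, fun k => (φ k).2, (tendsto_toL2_iff _ _).1 hφ, ?_, fun ψ hψ => ?_⟩
  · have h : Tendsto (fun kl : ℕ × ℕ => D (φ kl.1) - D (φ kl.2)) atTop (𝓝 (g - g)) := by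
      rw [← prod_atTop_atTop_eq]
      exact (hD.comp tendsto_fst).sub (hD.comp tendsto_snd)
    have h' := h.inner (𝕜 := ℂ) h
    simp only [sub_self, inner_zero_left, ← map_sub, ← hq] at h'
    exact h'
  · have h := (tendsto_const_nhds (x := D ⟨ψ, hψ⟩)).inner (𝕜 := ℂ) hD
    rw [hv, inner_toL2] at h
    simpa only [← hq] using h

/-- The form value of an element of the domain of the operator. -/
theorem exists_seq_of_mem_formOperator [CompleteSpace H]
    (hL : ∀ φ ∈ core, MemLp φ 2 m)
    (hq : ∀ ψ φ : core, q ψ φ = inner ℂ (D ψ) (D φ))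
    {u v : Lp ℂ 2 m} (h : (u, v) ∈ formOperator m (core : Set (Y → ℂ)) q) :
    ∃ φ : ℕ → core, Tendsto (fun k => toL2 core hL (φ k)) atTop (𝓝 u) ∧
      Tendsto (fun k => ‖D (φ k)‖ ^ 2) atTop (𝓝 (inner ℂ u v).re) := by
  obtain ⟨φ₀, hφ₀, hu, hc, hv⟩ := h
  lift φ₀ to ℕ → core using hφ₀
  have hu' := (tendsto_toL2_iff (hL := hL) φ₀ u).2 hu
  have hcau : CauchySeq fun k => D (φ₀ k) := by
    rw [cauchySeq_iff_tendsto_dist_atTop_0]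
    have h2 : Tendsto (fun kl : ℕ × ℕ =>
        √(q (φ₀ kl.1 - φ₀ kl.2 : Y → ℂ) (φ₀ kl.1 - φ₀ kl.2)).re) atTop (𝓝 0) := by
      have := ((Real.continuous_sqrt.comp Complex.continuous_re).tendsto 0).comp hc
      simp only [Function.comp_apply, Complex.zero_re, Real.sqrt_zero] at this
      exact this
    refine h2.congr fun kl => ?_
    have := hq (φ₀ kl.1 - φ₀ kl.2) (φ₀ kl.1 - φ₀ kl.2)
    rw [Submodule.coe_sub] at this
    rw [this, map_sub, dist_eq_norm, norm_eq_sqrt_re_inner (𝕜 := ℂ)]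
    rfl
  obtain ⟨g, hg⟩ := cauchySeq_tendsto_of_complete hcau
  -- The limit of `q ψ (φ₀ k)` is computed twice: through `D (φ₀ k) → g`, and from the definition of
  -- the operator.
  have key : ∀ ψ : core, inner ℂ (D ψ) g = inner ℂ (toL2 core hL ψ) v := fun ψ => by
    have h1 := hv ψ ψ.2
    rw [← inner_toL2 (hL := hL)] at h1
    simp only [hq] at h1
    exact tendsto_nhds_unique ((tendsto_const_nhds (x := D ψ)).inner (𝕜 := ℂ) hg) h1
  -- `⟨g, g⟩ = lim ⟨D φₖ, g⟩ = lim ⟨φₖ, v⟩ = ⟨u, v⟩`, using `key` at `ψ = φₖ`.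
  have hlim : inner ℂ g g = inner ℂ u v := by
    have h1 := hg.inner (𝕜 := ℂ) (tendsto_const_nhds (x := g))
    have h2 := hu'.inner (𝕜 := ℂ) (tendsto_const_nhds (x := v))
    simp only [key] at h1
    exact tendsto_nhds_unique h1 h2
  refine ⟨φ₀, hu', ?_⟩
  rw [← hlim]
  have h3 := (Complex.continuous_re.tendsto _).comp (hg.inner (𝕜 := ℂ) hg)
  refine h3.congr fun k => ?_
  exact (norm_sq_eq_re_inner (𝕜 := ℂ) (D (φ₀ k))).symm

/-- Elements of the core are approximated by elements of the domain of the operator, with control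
on the form. The approximation is the resolvent at `-l ^ 2`. -/
theorem exists_mem_formOperator [CompleteSpace H] (hL : ∀ φ ∈ core, MemLp φ 2 m)
    (hq : ∀ ψ φ : core, q ψ φ = inner ℂ (D ψ) (D φ)) (u : core) {l : ℝ} (hl : 0 < l) :
    ∃ w : Lp ℂ 2 m,
      (w, ((l ^ 2 : ℝ) : ℂ) • (toL2 core hL u - w)) ∈ formOperator m (core : Set (Y → ℂ)) q ∧
      l ^ 2 * ‖toL2 core hL u - w‖ ^ 2 ≤ ‖D u‖ ^ 2 ∧
      (inner ℂ w (((l ^ 2 : ℝ) : ℂ) • (toL2 core hL u - w))).re ≤ ‖D u‖ ^ 2 ∧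
      ∀ ψ : core, D ψ = 0 → inner ℂ (toL2 core hL ψ) w = inner ℂ (toL2 core hL ψ) (toL2 core hL u) := by
  set ι := toL2 core hL
  -- Projecting `(l u, 0)` onto the closure of `{(l ψ, D ψ)}` minimises `l²‖u - w‖² + ‖g‖²` over
  -- limits `(l w, g)`. The Euler–Lagrange equation `⟨Dψ, g⟩ = l²⟨ψ, u - w⟩` says that the operator
  -- sends `w` to `l²(u - w)`.
  let J : core →ₗ[ℂ] WithLp 2 (Lp ℂ 2 m × H) :=
    (WithLp.linearEquiv 2 ℂ (Lp ℂ 2 m × H)).symm.toLinearMap ∘ₗ (((l : ℂ) • ι).prod D)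
  set K := J.range.topologicalClosure
  have : CompleteSpace K := J.range.isClosed_topologicalClosure.completeSpace_coe
  set z : WithLp 2 (Lp ℂ 2 m × H) := WithLp.toLp 2 ((l : ℂ) • ι u, 0)
  set p := K.starProjection z
  have hpK : p ∈ K := K.starProjection_apply_mem z
  have horth : ∀ y ∈ K, inner ℂ y (z - p) = 0 := fun y hy =>
    (K.mem_orthogonal _).1 (K.sub_starProjection_mem_orthogonal z) y hy
  have hl' : (l : ℂ) ≠ 0 := by exact_mod_cast hl.ne'
  set w : Lp ℂ 2 m := (l : ℂ)⁻¹ • p.fst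
  have hpw : p.fst = (l : ℂ) • w := by simp [w, smul_smul, hl']
  obtain ⟨x, hx, hxp⟩ := mem_closure_iff_seq_limit.1 (show p ∈ closure (J.range : Set _) from hpK)
  choose φ hφ using hx
  have hfst : Tendsto (fun k => (l : ℂ) • ι (φ k)) atTop (𝓝 p.fst) := by
    have := ((WithLp.prod_continuous_ofLp 2 (Lp ℂ 2 m) H).fst.tendsto p).comp hxp
    refine this.congr fun k => ?_
    rw [Function.comp_apply, ← hφ k]; rfl
  have hsnd : Tendsto (fun k => D (φ k)) atTop (𝓝 p.snd) := by
    have := ((WithLp.prod_continuous_ofLp 2 (Lp ℂ 2 m) H).snd.tendsto p).comp hxp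
    refine this.congr fun k => ?_
    rw [Function.comp_apply, ← hφ k]; rfl
  have hw : Tendsto (fun k => ι (φ k)) atTop (𝓝 w) := by
    have := hfst.const_smul (l : ℂ)⁻¹
    refine this.congr fun k => ?_
    rw [smul_smul, inv_mul_cancel₀ hl', one_smul]
  have hin : ∀ (a : Lp ℂ 2 m) (b : H), inner ℂ (WithLp.toLp 2 (a, b)) (z - p) =
      (l : ℂ) * inner ℂ a (ι u - w) - inner ℂ b p.snd := fun a b => by
    rw [WithLp.prod_inner_apply]
    change inner ℂ a ((l : ℂ) • ι u - p.fst) + inner ℂ b (0 - p.snd) = _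
    rw [hpw, ← smul_sub, inner_smul_right, zero_sub, inner_neg_right]
    ring
  have hEL : ∀ ψ : core, inner ℂ (D ψ) p.snd = inner ℂ (ι ψ) (((l ^ 2 : ℝ) : ℂ) • (ι u - w)) :=
    fun ψ => by
      have h := horth (J ψ) (J.range.le_topologicalClosure ⟨ψ, rfl⟩)
      have h' : J ψ = WithLp.toLp 2 ((l : ℂ) • ι ψ, D ψ) := rfl
      rw [h', hin, inner_smul_left, Complex.conj_ofReal, ← mul_assoc] at h
      rw [inner_smul_right, ← sub_eq_zero.1 h]
      push_cast; ring
  -- The projection `p` lies in `K` itself, so the orthogonality relation may be tested at `p`.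
  have hpp : inner ℂ p.snd p.snd = inner ℂ w (((l ^ 2 : ℝ) : ℂ) • (ι u - w)) := by
    have h' : WithLp.toLp 2 ((l : ℂ) • w, p.snd) = p := by rw [← hpw]; rfl
    have h : inner ℂ (WithLp.toLp 2 ((l : ℂ) • w, p.snd)) (z - p) = 0 := by
      rw [h']; exact horth p hpK
    rw [hin, inner_smul_left, Complex.conj_ofReal, ← mul_assoc] at h
    rw [inner_smul_right, ← sub_eq_zero.1 h]
    push_cast; ring
  have hu := hEL u
  -- The Euler–Lagrange equation at `ψ = u`, with `u = w + (u - w)`. Together with Cauchy–Schwarz it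
  -- gives `‖g‖² + l²‖u - w‖² ≤ ‖Du‖‖g‖`, from which both bounds follow.
  have hsum : ‖p.snd‖ ^ 2 + l ^ 2 * ‖ι u - w‖ ^ 2 = (inner ℂ (D u) p.snd).re := by
    have h1 : inner ℂ (D u) p.snd = inner ℂ p.snd p.snd +
        ((l ^ 2 : ℝ) : ℂ) * inner ℂ (ι u - w) (ι u - w) := by
      rw [hu, hpp, ← inner_smul_right, ← inner_add_left]
      congr 1; abel
    rw [h1, Complex.add_re, Complex.re_ofReal_mul, norm_sq_eq_re_inner (𝕜 := ℂ) p.snd,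
      norm_sq_eq_re_inner (𝕜 := ℂ) (ι u - w)]
    rfl
  have hcs : (inner ℂ (D u) p.snd).re ≤ ‖D u‖ * ‖p.snd‖ :=
    (Complex.re_le_norm _).trans (norm_inner_le_norm _ _)
  have hp2 : (inner ℂ w (((l ^ 2 : ℝ) : ℂ) • (ι u - w))).re = ‖p.snd‖ ^ 2 := by
    rw [← hpp, inner_self_eq_norm_sq_to_K]; norm_cast
  refine ⟨w, mem_formOperator hq φ hw hsnd hEL, ?_, ?_, fun ψ hψ => ?_⟩
  · nlinarith [sq_nonneg (‖D u‖ - ‖p.snd‖), sq_nonneg ‖p.snd‖, sq_nonneg ‖D u‖]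
  · rw [hp2]
    nlinarith [sq_nonneg (‖D u‖ - ‖p.snd‖), sq_nonneg ‖p.snd‖, sq_nonneg ‖D u‖,
      mul_nonneg (sq_nonneg l) (sq_nonneg ‖ι u - w‖)]
  -- Null vectors of `D` do not see the resolvent: `⟨ψ, u - w⟩ = 0`. This keeps the approximants
  -- orthogonal to the constants.
  · have h := hEL ψ
    rw [hψ, inner_zero_left, inner_smul_right, inner_sub_right] at h
    have h2 : ((l ^ 2 : ℝ) : ℂ) ≠ 0 := by exact_mod_cast (pow_pos hl 2).ne'
    exact (sub_eq_zero.1 ((mul_eq_zero.1 h.symm).resolve_left h2)).symm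

/-- A spectral gap on the domain of the operator extends to the core of the form. -/
theorem gap_of_formOperator [CompleteSpace H] (hL : ∀ φ ∈ core, MemLp φ 2 m)
    (hq : ∀ ψ φ : core, q ψ φ = inner ℂ (D ψ) (D φ)) {e : core} (he : D e = 0) {Ξ : ℝ}
    (hgap : ∀ w v : Lp ℂ 2 m, (w, v) ∈ formOperator m (core : Set (Y → ℂ)) q →
      inner ℂ (toL2 core hL e) w = 0 → Ξ * ‖w‖ ^ 2 ≤ (inner ℂ w v).re)
    (u : core) (hu : inner ℂ (toL2 core hL e) (toL2 core hL u) = 0) :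
    Ξ * ‖toL2 core hL u‖ ^ 2 ≤ ‖D u‖ ^ 2 := by
  -- With `l = k + 1 > 0` the approximants satisfy `‖u - w k‖ ≤ ‖Du‖ / (k + 1)`, while their form
  -- values stay below `‖Du‖²`.
  choose w hw1 hw2 hw3 hw4 using fun k : ℕ =>
    exists_mem_formOperator hL hq u (show (0 : ℝ) < k + 1 by positivity)
  have hlim : Tendsto w atTop (𝓝 (toL2 core hL u)) := by
    rw [tendsto_iff_norm_sub_tendsto_zero]
    have h0 : Tendsto (fun k : ℕ => ‖D u‖ * (1 / ((k : ℝ) + 1))) atTop (𝓝 0) := by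
      simpa using tendsto_one_div_add_atTop_nhds_zero_nat.const_mul ‖D u‖
    refine squeeze_zero (fun _ => norm_nonneg _) (fun k => ?_) h0
    have hk : (0 : ℝ) < k + 1 := by positivity
    rw [norm_sub_rev, mul_one_div, le_div_iff₀ hk, mul_comm]
    refine le_of_sq_le_sq ?_ (norm_nonneg _)
    rw [mul_pow]
    exact hw2 k
  refine le_of_tendsto ((hlim.norm.pow 2).const_mul Ξ) (Eventually.of_forall fun k => ?_)
  exact (hgap _ _ (hw1 k) ((hw4 k e he).trans hu)).trans (hw3 k)

end FormOperator

/-! ### The gradient in a frame of vector fields -/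

theorem chart_coords {d : ℕ} (z : Hyp d) : chart (coords z) = z := by
  have hz : z.1 0 ^ 2 = 1 + ‖coords z‖ ^ 2 := by
    have h := z.2.2
    simp only [lorentz] at h
    rw [EuclideanSpace.real_norm_sq_eq]
    simp only [coords, pow_two]
    linarith
  refine Subtype.ext (funext fun k => ?_)
  refine Fin.cases ?_ (fun i => ?_) k
  · simp only [chart, Fin.cons_zero]
    rw [← hz, Real.sqrt_sq z.2.1.le]
  · simp [chart, coords]

theorem continuous_coords {d : ℕ} : Continuous (coords : Hyp d → EuclideanSpace ℝ (Fin d)) := by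
  refine (PiLp.continuous_toLp 2 _).comp (continuous_pi fun i => ?_)
  exact (continuous_apply i.succ).comp continuous_subtype_val

theorem chartTangent_apply {d : ℕ} (y : EuclideanSpace ℝ (Fin d)) (i : Fin d) :
    chartTangent y i 0 = y i / √(1 + ‖y‖ ^ 2) ∧
      ∀ j : Fin d, chartTangent y i j.succ = if j = i then 1 else 0 := by
  have hpos : 0 < 1 + ‖y‖ ^ 2 := by positivity
  have h0 : HasFDerivAt (fun y' : EuclideanSpace ℝ (Fin d) => √(1 + ‖y'‖ ^ 2))
      ((1 / (2 * √(1 + ‖y‖ ^ 2))) • (2 • innerSL ℝ y)) y :=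
    ((hasStrictFDerivAt_norm_sq y).hasFDerivAt.const_add 1).sqrt hpos.ne'
  let L : Fin (d + 1) → EuclideanSpace ℝ (Fin d) →L[ℝ] ℝ :=
    Fin.cons ((1 / (2 * √(1 + ‖y‖ ^ 2))) • (2 • innerSL ℝ y)) fun j => EuclideanSpace.proj j
  have h : HasFDerivAt (fun y' : EuclideanSpace ℝ (Fin d) => (chart y').1)
      (ContinuousLinearMap.pi L) y := by
    refine hasFDerivAt_pi.2 fun k => ?_
    refine Fin.cases ?_ (fun j => ?_) k
    · simpa [chart, L] using h0
    · simpa [chart, L] using (EuclideanSpace.proj (𝕜 := ℝ) j).hasFDerivAt (x := y)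
  simp only [chartTangent, h.fderiv]
  refine ⟨?_, fun j => ?_⟩
  · simp [L, EuclideanSpace.inner_single_right]
    field_simp
  · simp [L]

theorem metricTensor_eq {d : ℕ} (y : EuclideanSpace ℝ (Fin d)) :
    metricTensor y = 1 - (1 + ‖y‖ ^ 2)⁻¹ • Matrix.vecMulVec y.ofLp y.ofLp := by
  have hpos : 0 < 1 + ‖y‖ ^ 2 := by positivity
  ext i j
  have hs : √(1 + ‖y‖ ^ 2) * √(1 + ‖y‖ ^ 2) = 1 + ‖y‖ ^ 2 := Real.mul_self_sqrt hpos.le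
  simp only [metricTensor, Matrix.of_apply, lorentz, (chartTangent_apply y _).1,
    (chartTangent_apply y _).2, Matrix.sub_apply, Matrix.smul_apply, Matrix.vecMulVec_apply,
    Matrix.one_apply, div_mul_div_comm, hs, smul_eq_mul]
  simp [eq_comm (a := j)]
  ring

/-- The metric is a rank-one perturbation of the identity, so its inverse is `I + y yᵀ` by
Sherman–Morrison. -/
theorem metricTensor_inv {d : ℕ} (y : EuclideanSpace ℝ (Fin d)) :
    (metricTensor y)⁻¹ = 1 + Matrix.vecMulVec y.ofLp y.ofLp := by
  have hpos : 0 < 1 + ‖y‖ ^ 2 := by positivity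
  have hy : y.ofLp ⬝ᵥ y.ofLp = ‖y‖ ^ 2 := by
    rw [EuclideanSpace.real_norm_sq_eq]; simp [dotProduct, pow_two]
  refine Matrix.inv_eq_right_inv ?_
  rw [metricTensor_eq, sub_mul, one_mul, smul_mul_assoc, mul_add, mul_one,
    Matrix.vecMulVec_mul_vecMulVec, hy]
  rw [show Matrix.vecMulVec y.ofLp (‖y‖ ^ 2 • y.ofLp) = ‖y‖ ^ 2 • Matrix.vecMulVec y.ofLp y.ofLp from
    Matrix.vecMulVec_smul _ _ _]
  match_scalars
  · field_simp
  · field_simp; ring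

/-- The derivatives along a frame for which `⟨∇f, ∇h⟩` is the sum of the products of components. -/
def gradComp {d : ℕ} (f : Hyp d → ℂ) (a : Option (Fin d)) (z : Hyp d) : ℂ :=
  a.elim (∑ i, (coords z i : ℂ) * partialD f i z) fun i => partialD f i z

/-- As `g⁻¹ = I + y yᵀ`, the `d` coordinate fields and the radial field `y · ∂` (index `none`)
diagonalise the form. Using `d + 1` fields avoids taking a square root of `g⁻¹`. -/
theorem gradInner_eq {d : ℕ} (f h : Hyp d → ℂ) (z : Hyp d) :
    gradInner f h z = ∑ a, conj (gradComp f a z) * gradComp h a z := by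
  simp only [gradInner, gradComp, metricTensor_inv, Fintype.sum_option, Option.elim]
  simp only [Matrix.add_apply, Matrix.one_apply, Matrix.vecMulVec_apply, map_sum, map_mul,
    Complex.conj_ofReal, Finset.sum_mul_sum]
  push_cast
  simp only [add_mul, Finset.sum_add_distrib]
  rw [add_comm]
  congr 1
  · refine Finset.sum_congr rfl fun i _ => Finset.sum_congr rfl fun j _ => by ring
  · refine Finset.sum_congr rfl fun i _ => ?_
    rw [Finset.sum_eq_single i (fun j _ hj => by simp [hj.symm]) (by simp)]
    simp

/-- A function on `H^d` is differentiable if it is so in the global chart. -/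
def ChartDiff {d : ℕ} (f : Hyp d → ℂ) : Prop :=
  Differentiable ℝ fun y : EuclideanSpace ℝ (Fin d) => f (chart y)

theorem partialD_add {d : ℕ} {f h : Hyp d → ℂ} (hf : ChartDiff f) (hh : ChartDiff h) (i : Fin d)
    (z : Hyp d) : partialD (f + h) i z = partialD f i z + partialD h i z := by
  simp only [partialD, Pi.add_apply]
  rw [fderiv_fun_add (hf _) (hh _)]; rfl

theorem partialD_smul {d : ℕ} {f : Hyp d → ℂ} (hf : ChartDiff f) (c : ℂ) (i : Fin d)
    (z : Hyp d) : partialD (c • f) i z = c * partialD f i z := by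
  simp only [partialD, Pi.smul_apply]
  rw [fderiv_fun_const_smul (hf _)]; rfl

theorem gradComp_add {d : ℕ} {f h : Hyp d → ℂ} (hf : ChartDiff f) (hh : ChartDiff h)
    (a : Option (Fin d)) (z : Hyp d) : gradComp (f + h) a z = gradComp f a z + gradComp h a z := by
  cases a <;> simp [gradComp, partialD_add hf hh, mul_add, Finset.sum_add_distrib]

theorem gradComp_smul {d : ℕ} {f : Hyp d → ℂ} (hf : ChartDiff f) (c : ℂ)
    (a : Option (Fin d)) (z : Hyp d) : gradComp (c • f) a z = c * gradComp f a z := by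
  cases a
  · simp only [gradComp, partialD_smul hf, Option.elim, Finset.mul_sum]
    exact Finset.sum_congr rfl fun i _ => by ring
  · simp [gradComp, partialD_smul hf]

theorem gradComp_const {d : ℕ} (c : ℂ) (a : Option (Fin d)) (z : Hyp d) :
    gradComp (fun _ => c) a z = 0 := by
  cases a <;> simp [gradComp, partialD]

/-! ### Gradients valued in `L²` -/

section L2Gradient

variable {Y Z ι : Type*} [MeasurableSpace Z] {ν : Measure Z}

theorem integrable_conj_mul {c e : ι → Z → ℂ} (hc : ∀ a, MemLp (c a) 2 ν)
    (he : ∀ a, MemLp (e a) 2 ν) (a : ι) : Integrable (fun z => conj (c a z) * e a z) ν :=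
  (hc a).star.integrable_mul (he a)

variable [Fintype ι]

/-- The integrand is `∑ |c a|²`, which dominates each of its terms. Thus `∇φ ∈ L²` becomes a
condition on single components, which is visibly linear. -/
theorem integrable_sum_conj_mul_iff {c : ι → Z → ℂ} (hc : ∀ a, AEStronglyMeasurable (c a) ν) :
    Integrable (fun z => ∑ a, conj (c a z) * c a z) ν ↔ ∀ a, MemLp (c a) 2 ν := by
  refine ⟨fun h a => ?_, fun h => integrable_finsetSum _ fun a _ => integrable_conj_mul h h a⟩
  rw [memLp_two_iff_integrable_sq_norm (hc a)]
  refine h.mono ((hc a).norm.pow 2) (Eventually.of_forall fun z => ?_)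
  have h1 : ∑ b, conj (c b z) * c b z = ((∑ b, ‖c b z‖ ^ 2 : ℝ) : ℂ) := by
    push_cast
    exact Finset.sum_congr rfl fun b _ => by rw [mul_comm, Complex.mul_conj']
  rw [h1, Complex.norm_real, Real.norm_of_nonneg (by positivity),
    Real.norm_of_nonneg (Finset.sum_nonneg fun _ _ => by positivity)]
  exact Finset.single_le_sum (f := fun b => ‖c b z‖ ^ 2) (fun _ _ => by positivity)
    (Finset.mem_univ a)

/-- The linear map to `L²` given by square integrable components. -/
def l2Grad (core : Submodule ℂ (Y → ℂ)) (D : ι → (Y → ℂ) → Z → ℂ)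
    (hadd : ∀ a, ∀ φ ∈ core, ∀ ψ ∈ core, D a (φ + ψ) = D a φ + D a ψ)
    (hsmul : ∀ a, ∀ c : ℂ, ∀ φ ∈ core, D a (c • φ) = c • D a φ)
    (hmem : ∀ a, ∀ φ ∈ core, MemLp (D a φ) 2 ν) :
    core →ₗ[ℂ] PiLp 2 fun _ : ι => Lp ℂ 2 ν where
  toFun φ := WithLp.toLp 2 fun a => (hmem a φ φ.2).toLp _
  map_add' φ ψ := by
    ext1 a
    simp only [PiLp.add_apply]
    rw [← MemLp.toLp_add]
    exact MemLp.toLp_congr _ _ (by rw [Submodule.coe_add, hadd a φ φ.2 ψ ψ.2])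
  map_smul' c φ := by
    ext1 a
    simp only [PiLp.smul_apply, RingHom.id_apply]
    rw [← MemLp.toLp_const_smul]
    exact MemLp.toLp_congr _ _ (by rw [Submodule.coe_smul, hsmul a c φ φ.2])

theorem inner_l2Grad {core : Submodule ℂ (Y → ℂ)} {D : ι → (Y → ℂ) → Z → ℂ}
    (hadd : ∀ a, ∀ φ ∈ core, ∀ ψ ∈ core, D a (φ + ψ) = D a φ + D a ψ)
    (hsmul : ∀ a, ∀ c : ℂ, ∀ φ ∈ core, D a (c • φ) = c • D a φ)
    (hmem : ∀ a, ∀ φ ∈ core, MemLp (D a φ) 2 ν) (ψ φ : core) :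
    inner ℂ (l2Grad core D hadd hsmul hmem ψ) (l2Grad core D hadd hsmul hmem φ) =
      ∑ a, ∫ z, conj (D a ψ z) * D a φ z ∂ν := by
  rw [PiLp.inner_apply]
  refine Finset.sum_congr rfl fun a _ => ?_
  rw [L2.inner_def]
  refine integral_congr_ae ?_
  filter_upwards [(hmem a ψ ψ.2).coeFn_toLp, (hmem a φ φ.2).coeFn_toLp] with z h1 h2
  simp only [l2Grad, LinearMap.coe_mk, AddHom.coe_mk, h1, h2, RCLike.inner_apply]
  rw [mul_comm]

end L2Gradient

/-! ### Partial integration of square integrable functions -/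

section PartialIntegral

variable {α β : Type*} [MeasurableSpace α] [MeasurableSpace β]

theorem eLpNorm_two_sq {E : Type*} [NormedAddCommGroup E] (μ : Measure α) (f : α → E) :
    eLpNorm f 2 μ ^ 2 = ∫⁻ x, ‖f x‖ₑ ^ 2 ∂μ := by
  have h := eLpNorm_nnreal_pow_eq_lintegral (f := f) (p := 2) (μ := μ) two_ne_zero
  simpa using h

/-- Cauchy–Schwarz with values in `[0, ∞]`, so that no integrability has to be checked beforehand.
-/
theorem enorm_integral_mul_sq_le {μ : Measure α} {f g : α → ℂ} (hf : AEStronglyMeasurable f μ)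
    (hg : AEStronglyMeasurable g μ) :
    ‖∫ x, f x * g x ∂μ‖ₑ ^ 2 ≤ (∫⁻ x, ‖f x‖ₑ ^ 2 ∂μ) * ∫⁻ x, ‖g x‖ₑ ^ 2 ∂μ := by
  have h1 : ‖∫ x, f x * g x ∂μ‖ₑ ≤ ∫⁻ x, ‖f x‖ₑ * ‖g x‖ₑ ∂μ := by
    refine (enorm_integral_le_lintegral_enorm _).trans (le_of_eq ?_)
    simp only [enorm_mul]
  have h2 := ENNReal.lintegral_mul_le_Lp_mul_Lq μ Real.HolderConjugate.two_two hf.enorm hg.enorm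
  have h3 := pow_le_pow_left' (h1.trans h2) 2
  refine h3.trans (le_of_eq ?_)
  rw [mul_pow, ← ENNReal.rpow_natCast, ← ENNReal.rpow_natCast, ← ENNReal.rpow_mul,
    ← ENNReal.rpow_mul]
  norm_num

theorem ae_ae_swap {μ : Measure α} {ν : Measure β} [SFinite μ] [SFinite ν] {p : α × β → Prop}
    (h : ∀ᵐ z ∂μ.prod ν, p z) : ∀ᵐ y ∂ν, ∀ᵐ x ∂μ, p (x, y) :=
  Measure.ae_ae_of_ae_prod ((Measure.measurePreserving_swap (μ := ν) (ν := μ)).quasiMeasurePreserving.ae h)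

variable {μ : Measure α} {ν : Measure β} [IsFiniteMeasure μ] [IsFiniteMeasure ν]

theorem aestronglyMeasurable_partialIntegral {K : α × β → ℂ}
    (hK : AEStronglyMeasurable K (μ.prod ν)) {f : α → ℂ} (hf : AEStronglyMeasurable f μ) :
    AEStronglyMeasurable (fun y => ∫ x, K (x, y) * f x ∂μ) ν :=
  (hK.prod_swap.mul hf.comp_snd).integral_prod_right'

/-- The Hilbert–Schmidt bound: Cauchy–Schwarz in `x` for almost every `y`, then Tonelli. -/
theorem eLpNorm_partialIntegral_le {K : α × β → ℂ}
    (hK : AEStronglyMeasurable K (μ.prod ν)) {f : α → ℂ} (hf : AEStronglyMeasurable f μ) :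
    eLpNorm (fun y => ∫ x, K (x, y) * f x ∂μ) 2 ν ≤ eLpNorm K 2 (μ.prod ν) * eLpNorm f 2 μ := by
  rw [← ENNReal.pow_le_pow_left_iff two_ne_zero, mul_pow, eLpNorm_two_sq, eLpNorm_two_sq,
    eLpNorm_two_sq, lintegral_prod_symm _ (hK.enorm.pow_const 2),
    ← lintegral_mul_const'' _ (hK.enorm.pow_const 2).lintegral_prod_left']
  refine lintegral_mono_ae ?_
  filter_upwards [hK.prod_swap.prodMk_left] with y hy
  exact enorm_integral_mul_sq_le hy hf

theorem memLp_partialIntegral {K : α × β → ℂ} (hK : MemLp K 2 (μ.prod ν)) {f : α → ℂ}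
    (hf : MemLp f 2 μ) : MemLp (fun y => ∫ x, K (x, y) * f x ∂μ) 2 ν :=
  ⟨aestronglyMeasurable_partialIntegral hK.1 hf.1,
    (eLpNorm_partialIntegral_le hK.1 hf.1).trans_lt (ENNReal.mul_lt_top hK.2 hf.2)⟩

theorem integrable_slice_mul {K : α × β → ℂ} (hK : MemLp K 2 (μ.prod ν)) {f : α → ℂ}
    (hf : MemLp f 2 μ) : ∀ᵐ y ∂ν, Integrable (fun x => K (x, y) * f x) μ :=
  (hK.integrable_mul (hf.comp_fst ν)).prod_left_ae

/-- The map `(K, f) ↦ ∫ K(x, ·) f(x) dx`. -/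
def partialIntegral (μ : Measure α) (ν : Measure β) [IsFiniteMeasure μ] [IsFiniteMeasure ν] :
    Lp ℂ 2 (μ.prod ν) →L[ℂ] Lp ℂ 2 μ →L[ℂ] Lp ℂ 2 ν :=
  LinearMap.mkContinuous₂
    (LinearMap.mk₂ ℂ (fun K f => (memLp_partialIntegral (Lp.memLp K) (Lp.memLp f)).toLp _)
      (fun K K' f => by
        rw [← MemLp.toLp_add]
        refine MemLp.toLp_congr _ _ ?_
        filter_upwards [ae_ae_swap (Lp.coeFn_add K K'),
          integrable_slice_mul (Lp.memLp K) (Lp.memLp f),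
          integrable_slice_mul (Lp.memLp K') (Lp.memLp f)] with y h1 h2 h3
        rw [Pi.add_apply, ← integral_add h2 h3]
        refine integral_congr_ae ?_
        filter_upwards [h1] with x hx
        rw [hx, Pi.add_apply, add_mul])
      (fun c K f => by
        rw [← MemLp.toLp_const_smul]
        refine MemLp.toLp_congr _ _ ?_
        filter_upwards [ae_ae_swap (Lp.coeFn_smul c K)] with y h1
        rw [Pi.smul_apply, smul_eq_mul, ← integral_const_mul]
        refine integral_congr_ae ?_
        filter_upwards [h1] with x hx
        rw [hx, Pi.smul_apply, smul_eq_mul, mul_assoc])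
      (fun K f f' => by
        rw [← MemLp.toLp_add]
        refine MemLp.toLp_congr _ _ ?_
        filter_upwards [integrable_slice_mul (Lp.memLp K) (Lp.memLp f),
          integrable_slice_mul (Lp.memLp K) (Lp.memLp f')] with y h2 h3
        rw [Pi.add_apply, ← integral_add h2 h3]
        refine integral_congr_ae ?_
        filter_upwards [Lp.coeFn_add f f'] with x hx
        rw [hx, Pi.add_apply, mul_add])
      (fun c K f => by
        rw [← MemLp.toLp_const_smul]
        refine MemLp.toLp_congr _ _ (Eventually.of_forall fun y => ?_)
        rw [Pi.smul_apply, smul_eq_mul, ← integral_const_mul]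
        refine integral_congr_ae ?_
        filter_upwards [Lp.coeFn_smul c f] with x hx
        rw [hx, Pi.smul_apply, smul_eq_mul, mul_left_comm]))
    1 (fun K f => by
      rw [LinearMap.mk₂_apply, Lp.norm_toLp, one_mul, Lp.norm_def, Lp.norm_def,
        ← ENNReal.toReal_mul]
      exact ENNReal.toReal_mono (ENNReal.mul_ne_top (Lp.eLpNorm_ne_top K) (Lp.eLpNorm_ne_top f))
        (eLpNorm_partialIntegral_le (Lp.aestronglyMeasurable K) (Lp.aestronglyMeasurable f)))

theorem coeFn_partialIntegral {K : Lp ℂ 2 (μ.prod ν)} {f : Lp ℂ 2 μ} {K' : α × β → ℂ} {f' : α → ℂ}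
    (hK : K =ᵐ[μ.prod ν] K') (hf : f =ᵐ[μ] f') :
    partialIntegral μ ν K f =ᵐ[ν] fun y => ∫ x, K' (x, y) * f' x ∂μ := by
  have h := (memLp_partialIntegral (Lp.memLp K) (Lp.memLp f)).coeFn_toLp
  refine EventuallyEq.trans h ?_
  filter_upwards [ae_ae_swap hK] with y hy
  refine integral_congr_ae ?_
  filter_upwards [hy, hf] with x h1 h2
  rw [h1, h2]

theorem norm_sq_partialIntegral {K : Lp ℂ 2 (μ.prod ν)} {f : Lp ℂ 2 μ} {K' : α × β → ℂ}
    {f' : α → ℂ} (hK : K =ᵐ[μ.prod ν] K') (hf : f =ᵐ[μ] f') :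
    ‖partialIntegral μ ν K f‖ ^ 2 = ∫ y, ‖∫ x, K' (x, y) * f' x ∂μ‖ ^ 2 ∂ν := by
  rw [norm_sq_eq_re_inner (𝕜 := ℂ), L2.inner_def, ← integral_re (L2.integrable_inner _ _)]
  refine integral_congr_ae ?_
  filter_upwards [coeFn_partialIntegral hK hf] with y hy
  rw [← hy, ← norm_sq_eq_re_inner]

/-! ### Kernels `∫ G(x, y) conj G(x', y) dy` -/

/-- Finiteness of `μ` keeps a function that is constant in an extra variable square integrable. -/
theorem memLp_comp_snd_snd {G : α × β → ℂ} (hG : MemLp G 2 (μ.prod ν)) :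
    MemLp (fun q : (α × α) × β => G (q.1.2, q.2)) 2 ((μ.prod μ).prod ν) :=
  (hG.comp_snd μ).comp_measurePreserving (measurePreserving_prodAssoc μ μ ν)

theorem memLp_comp_fst_snd {G : α × β → ℂ} (hG : MemLp G 2 (μ.prod ν)) :
    MemLp (fun q : (α × α) × β => G (q.1.1, q.2)) 2 ((μ.prod μ).prod ν) :=
  (memLp_comp_snd_snd hG).comp_measurePreserving
    (Measure.measurePreserving_swap.prod (MeasurePreserving.id ν))

/-- Cauchy–Schwarz gives `|γ(x, x')|² ≤ ρ(x)ρ(x')` with `ρ(x) = ∫ |G(x, y)|² dy`, and `∫ ρ = ‖G‖²`.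
The arguments are swapped because `partialIntegral` integrates over the first variable of its
kernel. -/
theorem memLp_densityKernel {G : α × β → ℂ} (hG : MemLp G 2 (μ.prod ν)) :
    MemLp (fun p : α × α => ∫ y, G (p.2, y) * conj (G (p.1, y)) ∂ν) 2 (μ.prod μ) := by
  have hG1 := (memLp_comp_snd_snd hG).1
  have hG2 := (memLp_comp_fst_snd hG).1
  refine ⟨(hG1.mul (Complex.continuous_conj.comp_aestronglyMeasurable hG2)).integral_prod_right', ?_⟩
  have hlt : ∫⁻ x, ∫⁻ y, ‖G (x, y)‖ₑ ^ 2 ∂ν ∂μ < ⊤ := by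
    rw [← lintegral_prod _ (hG.1.enorm.pow_const 2), ← eLpNorm_two_sq]
    exact ENNReal.pow_lt_top hG.2
  have hm : AEMeasurable (fun x => ∫⁻ y, ‖G (x, y)‖ₑ ^ 2 ∂ν) μ :=
    (hG.1.enorm.pow_const 2).lintegral_prod_right'
  refine ((ENNReal.pow_lt_top_iff (n := 2)).1 ?_).resolve_right two_ne_zero
  rw [eLpNorm_two_sq]
  refine lt_of_le_of_lt (lintegral_mono_ae (g := fun p : α × α =>
    (∫⁻ y, ‖G (p.1, y)‖ₑ ^ 2 ∂ν) * ∫⁻ y, ‖G (p.2, y)‖ₑ ^ 2 ∂ν) ?_) ?_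
  · filter_upwards [hG1.prodMk_left, hG2.prodMk_left] with p h1 h2
    refine (enorm_integral_mul_sq_le h1
      (Complex.continuous_conj.comp_aestronglyMeasurable h2)).trans (le_of_eq ?_)
    simp only [RCLike.enorm_conj]
    rw [mul_comm]
  · rw [lintegral_prod_mul hm hm]
    exact ENNReal.mul_lt_top hlt hlt

/-- By Fubini the `y`-integral goes outside, and for fixed `y` the double integral factors as `|∫
G(x, y) dx|²`. -/
theorem integral_densityKernel {G : α × β → ℂ} (hG : MemLp G 2 (μ.prod ν)) :
    ∫ x, ∫ x', ∫ y, G (x, y) * conj (G (x', y)) ∂ν ∂μ ∂μ =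
      ((∫ y, ‖∫ x, G (x, y) ∂μ‖ ^ 2 ∂ν : ℝ) : ℂ) := by
  have h1 := memLp_comp_fst_snd hG
  have h2 := memLp_comp_snd_snd hG
  have hF : Integrable (fun q : (α × α) × β => G (q.1.1, q.2) * conj (G (q.1.2, q.2)))
      ((μ.prod μ).prod ν) := h1.integrable_mul h2.star
  have e1 := integral_prod _ hF.integral_prod_left
  rw [← e1, ← integral_prod _ hF, integral_prod_symm _ hF, ← integral_complex_ofReal]
  refine integral_congr_ae (Eventually.of_forall fun y => ?_)
  have e2 := integral_prod_mul (μ := μ) (ν := μ) (fun x => G (x, y)) fun x => conj (G (x, y))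
  simp only at e2 ⊢
  rw [e2, integral_conj, Complex.mul_conj']
  norm_cast

theorem inner_partialIntegral_const {K : Lp ℂ 2 (μ.prod μ)} {k : α → α → ℂ}
    (hK : K =ᵐ[μ.prod μ] fun p => k p.2 p.1) {e : Lp ℂ 2 μ} {c : ℂ} (he : e =ᵐ[μ] fun _ => c) :
    inner ℂ e (partialIntegral μ μ K e) = conj c * ((∫ x, ∫ x', k x x' ∂μ ∂μ) * c) := by
  rw [← integral_mul_const, ← integral_const_mul, L2.inner_def]
  refine integral_congr_ae ?_
  filter_upwards [he, coeFn_partialIntegral hK he] with x h1 h2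
  rw [h1, h2, RCLike.inner_apply, integral_mul_const, mul_comm]

end PartialIntegral

/-! ### The cores of the Laplacians on `X` and on `X^N` -/

theorem continuous_gradComp {d : ℕ} {T : Type*} [TopologicalSpace T] {f : T → Hyp d → ℂ}
    {p : T → Hyp d} (hp : Continuous p) (h : ∀ i, Continuous fun t => partialD (f t) i (p t))
    (a : Option (Fin d)) : Continuous fun t => gradComp (f t) a (p t) := by
  cases a with
  | none =>
    change Continuous fun t => ∑ i, (coords (p t) i : ℂ) * partialD (f t) i (p t)
    refine continuous_finsetSum _ fun i _ => Continuous.mul ?_ (h i)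
    exact Complex.continuous_ofReal.comp
      ((EuclideanSpace.proj (𝕜 := ℝ) i).continuous.comp (continuous_coords.comp hp))
  | some i => exact h i

theorem measurable_proj {d : ℕ} (Γ : Subgroup (Iso d)) : Measurable (proj Γ) :=
  measurable_quotient_mk''

instance isFiniteMeasure_fundVolume {d : ℕ} (Γ : Subgroup (Iso d)) [h : IsFiniteMeasure (volX Γ)] :
    IsFiniteMeasure (fundVolume Γ) :=
  ⟨by
    have h' := h.measure_univ_lt_top
    rwa [volX, Measure.map_apply (measurable_proj Γ) .univ, Set.preimage_univ] at h'⟩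

instance isFiniteMeasure_volXN {d : ℕ} (Γ : Subgroup (Iso d)) [IsFiniteMeasure (volX Γ)] (N : ℕ) :
    IsFiniteMeasure (volXN Γ N) := by
  unfold volXN; infer_instance

section Core

variable {d : ℕ} (Γ : Subgroup (Iso d))

/-- The components of the gradient of a function on `X`. -/
def gradX (a : Option (Fin d)) (φ : HypQuot Γ → ℂ) (z : Hyp d) : ℂ := gradComp (φ ∘ proj Γ) a z

variable {Γ} in
/-- Functions on `X` with smooth lift. -/
def SmoothLift (φ : HypQuot Γ → ℂ) : Prop :=
  ContDiff ℝ ∞ fun y : EuclideanSpace ℝ (Fin d) => φ (proj Γ (chart y))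

variable {Γ}

theorem SmoothLift.chartDiff {φ : HypQuot Γ → ℂ} (h : SmoothLift φ) : ChartDiff (φ ∘ proj Γ) :=
  h.differentiable (by simp)

theorem SmoothLift.aestronglyMeasurable_gradX {φ : HypQuot Γ → ℂ} (h : SmoothLift φ)
    (a : Option (Fin d)) (ν : Measure (Hyp d)) : AEStronglyMeasurable (gradX Γ a φ) ν := by
  refine Continuous.aestronglyMeasurable
    (continuous_gradComp (f := fun _ => φ ∘ proj Γ) continuous_id (fun i => ?_) a)
  have h1 : Continuous (fderiv ℝ fun y : EuclideanSpace ℝ (Fin d) => φ (proj Γ (chart y))) :=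
    h.continuous_fderiv (by simp)
  exact (h1.comp continuous_coords).clm_apply continuous_const

theorem mem_smoothX_iff {φ : HypQuot Γ → ℂ} :
    φ ∈ smoothX Γ ↔ SmoothLift φ ∧ MemLp φ 2 (volX Γ) ∧
      ∀ a, MemLp (gradX Γ a φ) 2 (fundVolume Γ) := by
  refine and_congr_right fun (h : SmoothLift φ) => and_congr_right fun _ => ?_
  rw [← integrable_sum_conj_mul_iff fun a => h.aestronglyMeasurable_gradX a _]
  simp only [gradInner_eq, gradX]

theorem gradX_add {φ ψ : HypQuot Γ → ℂ} (hφ : SmoothLift φ) (hψ : SmoothLift ψ)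
    (a : Option (Fin d)) : gradX Γ a (φ + ψ) = gradX Γ a φ + gradX Γ a ψ :=
  funext fun z => gradComp_add hφ.chartDiff hψ.chartDiff a z

theorem gradX_smul {φ : HypQuot Γ → ℂ} (hφ : SmoothLift φ) (c : ℂ) (a : Option (Fin d)) :
    gradX Γ a (c • φ) = c • gradX Γ a φ :=
  funext fun z => gradComp_smul hφ.chartDiff c a z

theorem gradX_const (c : ℂ) (a : Option (Fin d)) : gradX Γ a (fun _ => c) = 0 :=
  funext fun z => gradComp_const c a z

theorem const_mem_smoothX [IsFiniteMeasure (volX Γ)] (c : ℂ) : (fun _ => c) ∈ smoothX Γ := by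
  refine mem_smoothX_iff.2 ⟨contDiff_const, memLp_const c, fun a => ?_⟩
  rw [gradX_const]
  exact MemLp.zero

variable (Γ)

/-- The space `smoothX` as a submodule. -/
def coreX : Submodule ℂ (HypQuot Γ → ℂ) where
  carrier := smoothX Γ
  zero_mem' := mem_smoothX_iff.2 ⟨contDiff_const, MemLp.zero, fun a => by
    rw [show (0 : HypQuot Γ → ℂ) = fun _ => 0 from rfl, gradX_const]; exact MemLp.zero⟩
  add_mem' {φ ψ} h1 h2 := by
    rw [mem_smoothX_iff] at *
    refine ⟨h1.1.add h2.1, h1.2.1.add h2.2.1, fun a => ?_⟩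
    rw [gradX_add h1.1 h2.1]
    exact (h1.2.2 a).add (h2.2.2 a)
  smul_mem' c φ h1 := by
    rw [mem_smoothX_iff] at *
    refine ⟨h1.1.const_smul c, h1.2.1.const_smul c, fun a => ?_⟩
    rw [gradX_smul h1.1]
    exact (h1.2.2 a).const_smul c

/-- The gradient on `smoothX`. -/
def gradMapX : coreX Γ →ₗ[ℂ] PiLp 2 fun _ : Option (Fin d) => Lp ℂ 2 (fundVolume Γ) :=
  l2Grad (coreX Γ) (gradX Γ)
    (fun a _ hφ _ hψ => gradX_add (mem_smoothX_iff.1 hφ).1 (mem_smoothX_iff.1 hψ).1 a)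
    (fun a c _ hφ => gradX_smul (mem_smoothX_iff.1 hφ).1 c a)
    fun a _ hφ => (mem_smoothX_iff.1 hφ).2.2 a

theorem memLp_of_mem_coreX : ∀ φ ∈ coreX Γ, MemLp φ 2 (volX Γ) :=
  fun _ hφ => (mem_smoothX_iff.1 hφ).2.1

/-- This puts the Dirichlet form in the shape `⟨Dψ, Dφ⟩` with a complete target, as the lemmas on
form operators require. -/
theorem energyX_eq (ψ φ : coreX Γ) :
    energyX Γ ψ φ = inner ℂ (gradMapX Γ ψ) (gradMapX Γ φ) := by
  rw [gradMapX, inner_l2Grad, ← integral_finsetSum _ fun a _ => integrable_conj_mul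
    (mem_smoothX_iff.1 ψ.2).2.2 (mem_smoothX_iff.1 φ.2).2.2 a]
  simp only [energyX, gradInner_eq, gradX]

theorem gradMapX_const [IsFiniteMeasure (volX Γ)] (c : ℂ) :
    gradMapX Γ ⟨fun _ => c, const_mem_smoothX c⟩ = 0 := by
  have h : inner ℂ (gradMapX Γ ⟨fun _ => c, const_mem_smoothX c⟩)
      (gradMapX Γ ⟨fun _ => c, const_mem_smoothX c⟩) = 0 := by
    rw [gradMapX, inner_l2Grad]
    simp [gradX_const]
  exact inner_self_eq_zero.1 h

variable {N : ℕ}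

/-- The components of the gradient of a function on `X^N`. -/
def gradXN (b : Fin N × Option (Fin d)) (φ : (Fin N → HypQuot Γ) → ℂ) (z : Fin N → Hyp d) : ℂ :=
  gradComp (liftSlice Γ φ b.1 z) b.2 (z b.1)

variable {Γ} in
/-- Functions on `X^N` with smooth lift. -/
def SmoothLiftN (φ : (Fin N → HypQuot Γ) → ℂ) : Prop :=
  ContDiff ℝ ∞ fun y : Fin N → EuclideanSpace ℝ (Fin d) => φ fun i => proj Γ (chart (y i))

variable {Γ}

theorem liftSlice_chart (φ : (Fin N → HypQuot Γ) → ℂ) (i : Fin N) (z : Fin N → Hyp d)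
    (y : EuclideanSpace ℝ (Fin d)) :
    liftSlice Γ φ i z (chart y) =
      φ fun j => proj Γ (chart (Function.update (fun k => coords (z k)) i y j)) := by
  refine congrArg φ (funext fun j => ?_)
  rcases eq_or_ne j i with rfl | hj
  · simp
  · simp [hj, chart_coords]

theorem SmoothLiftN.contDiff_liftSlice {φ : (Fin N → HypQuot Γ) → ℂ} (h : SmoothLiftN φ)
    (i : Fin N) (z : Fin N → Hyp d) :
    ContDiff ℝ ∞ fun y : EuclideanSpace ℝ (Fin d) => liftSlice Γ φ i z (chart y) := by
  simp only [liftSlice_chart]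
  exact ContDiff.comp
    (g := fun y : Fin N → EuclideanSpace ℝ (Fin d) => φ fun i => proj Γ (chart (y i))) h
    (contDiff_update ∞ _ i)

theorem SmoothLiftN.chartDiff {φ : (Fin N → HypQuot Γ) → ℂ} (h : SmoothLiftN φ) (i : Fin N)
    (z : Fin N → Hyp d) : ChartDiff (liftSlice Γ φ i z) :=
  (h.contDiff_liftSlice i z).differentiable (by simp)

/-- The slice itself varies with `z`. Expressed through the full derivative, its partial derivative
is jointly continuous in all variables, hence measurable on the product. -/
theorem SmoothLiftN.partialD_liftSlice {φ : (Fin N → HypQuot Γ) → ℂ} (h : SmoothLiftN φ)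
    (i : Fin N) (z : Fin N → Hyp d) (j : Fin d) :
    partialD (liftSlice Γ φ i z) j (z i) =
      fderiv ℝ (fun y : Fin N → EuclideanSpace ℝ (Fin d) => φ fun i => proj Γ (chart (y i)))
        (fun k => coords (z k)) (Pi.single i (EuclideanSpace.single j 1)) := by
  let Φ := fun y : Fin N → EuclideanSpace ℝ (Fin d) => φ fun i => proj Γ (chart (y i))
  have h1 : HasFDerivAt Φ (fderiv ℝ Φ fun k => coords (z k))
      (Function.update (fun k => coords (z k)) i (coords (z i))) := by
    rw [Function.update_eq_self (f := fun k => coords (z k))]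
    exact (h.differentiable (by simp) _).hasFDerivAt
  have h2 := hasFDerivAt_update (𝕜 := ℝ) (fun k => coords (z k)) (i := i) (coords (z i))
  have h3 := (h1.comp (coords (z i)) h2).fderiv
  have h4 : (fun y => liftSlice Γ φ i z (chart y)) =
      Φ ∘ Function.update (fun k => coords (z k)) i := funext fun y => liftSlice_chart φ i z y
  rw [partialD, h4, h3, ContinuousLinearMap.comp_apply]
  congr 1
  ext k : 1
  rcases eq_or_ne k i with rfl | hk
  · simp
  · simp [hk]

theorem SmoothLiftN.aestronglyMeasurable_gradXN {φ : (Fin N → HypQuot Γ) → ℂ}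
    (h : SmoothLiftN φ) (b : Fin N × Option (Fin d)) (ν : Measure (Fin N → Hyp d)) :
    AEStronglyMeasurable (gradXN Γ b φ) ν := by
  refine Continuous.aestronglyMeasurable
    (continuous_gradComp (f := fun z => liftSlice Γ φ b.1 z) (continuous_apply b.1) (fun j => ?_) b.2)
  simp only [h.partialD_liftSlice]
  have h1 := h.continuous_fderiv (by simp)
  have h2 : Continuous fun (z : Fin N → Hyp d) k => coords (z k) :=
    continuous_pi fun k => continuous_coords.comp (continuous_apply k)
  exact (h1.comp h2).clm_apply continuous_const

theorem mem_smoothXN_iff {φ : (Fin N → HypQuot Γ) → ℂ} :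
    φ ∈ smoothXN Γ N ↔ SmoothLiftN φ ∧ MemLp φ 2 (volXN Γ N) ∧
      ∀ b, MemLp (gradXN Γ b φ) 2 (Measure.pi fun _ : Fin N => fundVolume Γ) := by
  refine and_congr_right fun (h : SmoothLiftN φ) => and_congr_right fun _ => ?_
  rw [Prod.forall]
  refine forall_congr' fun i => ?_
  rw [← integrable_sum_conj_mul_iff fun a => h.aestronglyMeasurable_gradXN (i, a) _]
  refine iff_of_eq (congrArg₂ _ (funext fun z => ?_) rfl)
  simp only [gradInnerN, gradInner_eq, gradXN]

theorem gradXN_add {φ ψ : (Fin N → HypQuot Γ) → ℂ} (hφ : SmoothLiftN φ) (hψ : SmoothLiftN ψ)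
    (b : Fin N × Option (Fin d)) : gradXN Γ b (φ + ψ) = gradXN Γ b φ + gradXN Γ b ψ :=
  funext fun z => gradComp_add (hφ.chartDiff b.1 z) (hψ.chartDiff b.1 z) b.2 (z b.1)

theorem gradXN_smul {φ : (Fin N → HypQuot Γ) → ℂ} (hφ : SmoothLiftN φ) (c : ℂ)
    (b : Fin N × Option (Fin d)) : gradXN Γ b (c • φ) = c • gradXN Γ b φ :=
  funext fun z => gradComp_smul (hφ.chartDiff b.1 z) c b.2 (z b.1)

variable (Γ N)

/-- The space `smoothXN` as a submodule. -/
def coreXN : Submodule ℂ ((Fin N → HypQuot Γ) → ℂ) where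
  carrier := smoothXN Γ N
  zero_mem' := mem_smoothXN_iff.2 ⟨contDiff_const, MemLp.zero, fun b => by
    have h : gradXN Γ b (0 : (Fin N → HypQuot Γ) → ℂ) = 0 := funext fun z => gradComp_const 0 _ _
    rw [h]; exact MemLp.zero⟩
  add_mem' {φ ψ} h1 h2 := by
    rw [mem_smoothXN_iff] at *
    refine ⟨h1.1.add h2.1, h1.2.1.add h2.2.1, fun b => ?_⟩
    rw [gradXN_add h1.1 h2.1]
    exact (h1.2.2 b).add (h2.2.2 b)
  smul_mem' c φ h1 := by
    rw [mem_smoothXN_iff] at *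
    refine ⟨h1.1.const_smul c, h1.2.1.const_smul c, fun b => ?_⟩
    rw [gradXN_smul h1.1]
    exact (h1.2.2 b).const_smul c

/-- The gradient on `smoothXN`. -/
def gradMapXN : coreXN Γ N →ₗ[ℂ] PiLp 2 fun _ : Fin N × Option (Fin d) =>
    Lp ℂ 2 (Measure.pi fun _ : Fin N => fundVolume Γ) :=
  l2Grad (coreXN Γ N) (gradXN Γ)
    (fun b _ hφ _ hψ => gradXN_add (mem_smoothXN_iff.1 hφ).1 (mem_smoothXN_iff.1 hψ).1 b)
    (fun b c _ hφ => gradXN_smul (mem_smoothXN_iff.1 hφ).1 c b)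
    fun b _ hφ => (mem_smoothXN_iff.1 hφ).2.2 b

theorem memLp_of_mem_coreXN : ∀ φ ∈ coreXN Γ N, MemLp φ 2 (volXN Γ N) :=
  fun _ hφ => (mem_smoothXN_iff.1 hφ).2.1

theorem energyXN_eq (ψ φ : coreXN Γ N) :
    energyXN Γ N ψ φ = inner ℂ (gradMapXN Γ N ψ) (gradMapXN Γ N φ) := by
  rw [gradMapXN, inner_l2Grad, Fintype.sum_prod_type]
  refine Finset.sum_congr rfl fun i _ => ?_
  rw [← integral_finsetSum _ fun a _ => integrable_conj_mul
    (mem_smoothXN_iff.1 ψ.2).2.2 (mem_smoothXN_iff.1 φ.2).2.2 (i, a)]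
  simp only [gradInnerN, gradInner_eq, gradXN]

end Core

/-! ### The Poincaré inequality on `X` -/

theorem norm_sq_toL2 {Y : Type*} [MeasurableSpace Y] {m : Measure Y} {core : Submodule ℂ (Y → ℂ)}
    {hL : ∀ φ ∈ core, MemLp φ 2 m} (φ : core) :
    ‖toL2 core hL φ‖ ^ 2 = ∫ y, ‖(φ : Y → ℂ) y‖ ^ 2 ∂m := by
  rw [norm_sq_eq_re_inner (𝕜 := ℂ), L2.inner_def, ← integral_re (L2.integrable_inner _ _)]
  refine integral_congr_ae ?_
  filter_upwards [coeFn_toL2 (hL := hL) φ] with y hy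
  rw [← norm_sq_eq_re_inner, hy]

theorem norm_sq_l2Grad {Y Z ι : Type*} [MeasurableSpace Z] {ν : Measure Z} [Fintype ι]
    {core : Submodule ℂ (Y → ℂ)} {D : ι → (Y → ℂ) → Z → ℂ}
    (hadd : ∀ a, ∀ φ ∈ core, ∀ ψ ∈ core, D a (φ + ψ) = D a φ + D a ψ)
    (hsmul : ∀ a, ∀ c : ℂ, ∀ φ ∈ core, D a (c • φ) = c • D a φ)
    (hmem : ∀ a, ∀ φ ∈ core, MemLp (D a φ) 2 ν) (φ : core) :
    ‖l2Grad core D hadd hsmul hmem φ‖ ^ 2 = ∑ a, ∫ z, ‖D a φ z‖ ^ 2 ∂ν := by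
  rw [norm_sq_eq_re_inner (𝕜 := ℂ), inner_l2Grad, map_sum]
  refine Finset.sum_congr rfl fun a _ => ?_
  rw [← integral_re (integrable_conj_mul (c := fun a => D a φ) (e := fun a => D a φ)
    (fun a => hmem a φ φ.2) (fun a => hmem a φ φ.2) a)]
  refine integral_congr_ae (Eventually.of_forall fun z => ?_)
  simp only
  rw [mul_comm, Complex.mul_conj']
  norm_cast

/-- A spectral gap above a single null vector, without an orthogonality assumption. -/
theorem poincare_of_formOperator {Y H : Type*} [MeasurableSpace Y] {m : Measure Y}
    [NormedAddCommGroup H] [InnerProductSpace ℂ H] [CompleteSpace H] {core : Submodule ℂ (Y → ℂ)}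
    {q : (Y → ℂ) → (Y → ℂ) → ℂ} {D : core →ₗ[ℂ] H} (hL : ∀ φ ∈ core, MemLp φ 2 m)
    (hq : ∀ ψ φ : core, q ψ φ = inner ℂ (D ψ) (D φ)) {e : core} (he : D e = 0)
    (hnorm : ‖toL2 core hL e‖ = 1) {Ξ : ℝ}
    (hgap : ∀ w v : Lp ℂ 2 m, (w, v) ∈ formOperator m (core : Set (Y → ℂ)) q →
      inner ℂ (toL2 core hL e) w = 0 → Ξ * ‖w‖ ^ 2 ≤ (inner ℂ w v).re) (φ : core) :
    Ξ * (‖toL2 core hL φ‖ ^ 2 - ‖inner ℂ (toL2 core hL e) (toL2 core hL φ)‖ ^ 2) ≤ ‖D φ‖ ^ 2 := by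
  set ι := toL2 core hL
  have h1 : inner ℂ (ι e) (ι e) = 1 := inner_self_eq_one_of_norm_eq_one hnorm
  set s := inner ℂ (ι e) (ι φ)
  -- Removing the component `s • e` leaves `D φ` unchanged because `D e = 0`, and Pythagoras
  -- accounts for the loss of norm.
  have horth : inner ℂ (ι e) (ι (φ - s • e)) = 0 := by
    rw [map_sub, map_smul, inner_sub_right, inner_smul_right, h1, mul_one, sub_self]
  have h := gap_of_formOperator hL hq he hgap (φ - s • e) horth
  have hpyth : ‖ι φ‖ ^ 2 = ‖ι (φ - s • e)‖ ^ 2 + ‖s‖ ^ 2 := by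
    have h2 : ι φ = ι (φ - s • e) + s • ι e := by rw [map_sub, map_smul, sub_add_cancel]
    have h3 := norm_add_sq_eq_norm_sq_add_norm_sq_of_inner_eq_zero (𝕜 := ℂ)
      (ι (φ - s • e)) (s • ι e) (by
        rw [inner_smul_right, ← inner_conj_symm, horth, map_zero, mul_zero])
    rw [← h2, norm_smul, hnorm, mul_one] at h3
    simpa only [pow_two] using h3
  rw [map_sub D, map_smul, he, smul_zero, sub_zero] at h
  rw [hpyth, add_sub_cancel_right]
  exact h

/-! ### Slices of functions on `X^N` in one variable -/

section Slice

variable {d : ℕ} {Γ : Subgroup (Iso d)}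

theorem liftSlice_insertNth {n : ℕ} (φ : (Fin (n + 1) → HypQuot Γ) → ℂ) (i : Fin (n + 1))
    (z : Hyp d) (zs : Fin n → Hyp d) :
    liftSlice Γ φ i (i.insertNth (α := fun _ => Hyp d) z zs) =
      (fun x => φ (i.insertNth (α := fun _ => HypQuot Γ) x fun j => proj Γ (zs j))) ∘ proj Γ := by
  funext t
  refine congrArg φ (funext fun j => ?_)
  rcases Fin.eq_self_or_eq_succAbove i j with rfl | ⟨k, rfl⟩
  · simp
  · simp [Fin.succAbove_ne]

theorem gradXN_insertNth {n : ℕ} (φ : (Fin (n + 1) → HypQuot Γ) → ℂ) (i : Fin (n + 1))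
    (a : Option (Fin d)) (z : Hyp d) (zs : Fin n → Hyp d) :
    gradXN Γ (i, a) φ (i.insertNth (α := fun _ => Hyp d) z zs) =
      gradX Γ a (fun x => φ (i.insertNth (α := fun _ => HypQuot Γ) x fun j => proj Γ (zs j))) z := by
  simp only [gradXN, gradX, liftSlice_insertNth, Fin.insertNth_apply_same]

end Slice

section Gap

variable {d : ℕ} {Γ : Subgroup (Iso d)} [IsFiniteMeasure (volX Γ)]

/-- The value of the normalized constant function. -/
def constVal (Γ : Subgroup (Iso d)) : ℂ := (((√((volX Γ).real Set.univ))⁻¹ : ℝ) : ℂ)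

theorem coeFn_constState : constState Γ =ᵐ[volX Γ] fun _ => constVal Γ := Lp.coeFn_const _ _ _

theorem toL2_const : toL2 (coreX Γ) (memLp_of_mem_coreX Γ)
    ⟨fun _ => constVal Γ, const_mem_smoothX _⟩ = constState Γ :=
  Lp.ext ((coeFn_toL2 _).trans coeFn_constState.symm)

/-- For `vol X = 0` the space `L²(X)` is trivial, so the volume must be nonzero. -/
theorem norm_constState (hX : volX Γ ≠ 0) : ‖constState Γ‖ = 1 := by
  have hpos : 0 < (volX Γ).real Set.univ :=
    ENNReal.toReal_pos (by simpa using hX) (measure_ne_top _ _)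
  rw [← sq_eq_sq₀ (norm_nonneg _) zero_le_one, ← toL2_const, norm_sq_toL2]
  simp only [integral_const, constVal, Complex.norm_real, norm_inv, inv_pow, smul_eq_mul]
  rw [Real.norm_of_nonneg (Real.sqrt_nonneg _), Real.sq_sqrt hpos.le, mul_inv_cancel₀ hpos.ne',
    one_pow]

theorem poincare_coreX (hX : volX Γ ≠ 0) {Ξ : ℝ} (hgap : HasSpectralGap Γ Ξ) (φ : coreX Γ) :
    Ξ * (‖toL2 (coreX Γ) (memLp_of_mem_coreX Γ) φ‖ ^ 2 -
      ‖inner ℂ (constState Γ) (toL2 (coreX Γ) (memLp_of_mem_coreX Γ) φ)‖ ^ 2) ≤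
      ‖gradMapX Γ φ‖ ^ 2 := by
  have h := poincare_of_formOperator (memLp_of_mem_coreX Γ) (energyX_eq Γ) (gradMapX_const Γ _)
    (by rw [toL2_const, norm_constState hX])
    (fun w v hwv hw => hgap w v hwv (by rwa [← toL2_const])) φ
  rwa [toL2_const] at h

theorem poincare_smoothX (hX : volX Γ ≠ 0) {Ξ : ℝ} (hgap : HasSpectralGap Γ Ξ)
    {φ : HypQuot Γ → ℂ} (hφ : φ ∈ smoothX Γ) :
    Ξ * (∫ x, ‖φ x‖ ^ 2 ∂(volX Γ) - ‖∫ x, φ x * constVal Γ ∂(volX Γ)‖ ^ 2) ≤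
      ∑ a, ∫ z, ‖gradX Γ a φ z‖ ^ 2 ∂(fundVolume Γ) := by
  have h := poincare_coreX hX hgap ⟨φ, hφ⟩
  rw [norm_sq_toL2, gradMapX, norm_sq_l2Grad, ← toL2_const, inner_toL2] at h
  convert h using 5
  refine integral_congr_ae ?_
  filter_upwards [coeFn_toL2 (hL := memLp_of_mem_coreX Γ) ⟨φ, hφ⟩] with x hx
  rw [hx, mul_comm, constVal, Complex.conj_ofReal]

/-! ### The inequality in one variable of a function on `X^N` -/

theorem measurePreserving_insertNth {α : Type*} [MeasurableSpace α] (μ : Measure α)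
    [SigmaFinite μ] {n : ℕ} (i : Fin (n + 1)) :
    MeasurePreserving (fun p : α × (Fin n → α) => i.insertNth (α := fun _ => α) p.1 p.2)
      (μ.prod (Measure.pi fun _ => μ)) (Measure.pi fun _ => μ) :=
  (measurePreserving_piFinSuccAbove (fun _ => μ) i).symm

/-- Functions live on `X^n` but their gradients on `(H^d)^n`. This lets both be integrated over the
same space. -/
theorem measurePreserving_projN (n : ℕ) :
    MeasurePreserving (fun (z : Fin n → Hyp d) j => proj Γ (z j))
      (Measure.pi fun _ => fundVolume Γ) (volXN Γ n) := by
  refine ⟨measurable_pi_lambda _ fun j => (measurable_proj Γ).comp (measurable_pi_apply j), ?_⟩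
  have : SigmaFinite ((fundVolume Γ).map (proj Γ)) :=
    (inferInstance : IsFiniteMeasure (volX Γ)).toSigmaFinite
  exact Measure.pi_map_pi fun _ => (measurable_proj Γ).aemeasurable

/-- The `i`-th variable of an element of `L²(X^(n+1))` is separated from the others. -/
def splitAt (n : ℕ) (i : Fin (n + 1)) :
    L2XN Γ (n + 1) →ₗᵢ[ℂ] Lp ℂ 2 ((volX Γ).prod (volXN Γ n)) :=
  Lp.compMeasurePreservingₗᵢ ℂ _ (measurePreserving_insertNth (volX Γ) i)

/-- The component of a function along the constants in the `i`-th variable. -/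
def constPart {n : ℕ} (i : Fin (n + 1)) (Ψ : L2XN Γ (n + 1)) : L2XN Γ n :=
  partialIntegral (volX Γ) (volXN Γ n) (splitAt n i Ψ) (constState Γ)

theorem continuous_constPart {n : ℕ} (i : Fin (n + 1)) :
    Continuous (constPart i : L2XN Γ (n + 1) → L2XN Γ n) :=
  ((partialIntegral (volX Γ) (volXN Γ n)).continuous.comp (splitAt n i).continuous).clm_apply
    continuous_const

theorem coeFn_splitAt {n : ℕ} (i : Fin (n + 1)) {Ψ : L2XN Γ (n + 1)}
    {φ : (Fin (n + 1) → HypQuot Γ) → ℂ} (h : Ψ =ᵐ[volXN Γ (n + 1)] φ) :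
    splitAt n i Ψ =ᵐ[(volX Γ).prod (volXN Γ n)]
      fun p => φ (i.insertNth (α := fun _ => HypQuot Γ) p.1 p.2) :=
  (Lp.coeFn_compMeasurePreserving Ψ (measurePreserving_insertNth (volX Γ) i)).trans
    ((measurePreserving_insertNth (volX Γ) i).quasiMeasurePreserving.ae_eq_comp h)

/-- Smoothness passes to every slice; by Fubini, square integrability of `φ` and of its `i`-th
gradient passes to almost every slice. -/
theorem ae_slice_mem_smoothX {n : ℕ} (φ : coreXN Γ (n + 1)) (i : Fin (n + 1)) :
    ∀ᵐ zs ∂(Measure.pi fun _ : Fin n => fundVolume Γ),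
      (fun x => (φ : (Fin (n + 1) → HypQuot Γ) → ℂ)
        (i.insertNth (α := fun _ => HypQuot Γ) x fun j => proj Γ (zs j))) ∈ smoothX Γ := by
  obtain ⟨hs, hφ, hD⟩ := mem_smoothXN_iff.1 φ.2
  have hG := hφ.comp_measurePreserving (measurePreserving_insertNth (volX Γ) i)
  have hG1 := (measurePreserving_projN (Γ := Γ) n).quasiMeasurePreserving.ae
    hG.1.prod_swap.prodMk_left
  have hG2 := (measurePreserving_projN (Γ := Γ) n).quasiMeasurePreserving.ae
    ((memLp_two_iff_integrable_sq_norm hG.1).1 hG).prod_left_ae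
  have hE := fun a => (hD (i, a)).comp_measurePreserving (measurePreserving_insertNth (fundVolume Γ) i)
  have hE1 := ae_all_iff.2 fun a => (hE a).1.prod_swap.prodMk_left
  have hE2 := ae_all_iff.2 fun a => ((memLp_two_iff_integrable_sq_norm (hE a).1).1 (hE a)).prod_left_ae
  filter_upwards [hG1, hG2, hE1, hE2] with zs h1 h2 h3 h4
  refine mem_smoothX_iff.2 ⟨?_, (memLp_two_iff_integrable_sq_norm h1).2 h2, fun a => ?_⟩
  -- The point `chart 0` in slot `i` is a dummy, overwritten by the slice variable.
  · have h := hs.contDiff_liftSlice i (i.insertNth (α := fun _ => Hyp d) (chart 0) zs)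
    rwa [liftSlice_insertNth] at h
  · have h5 := (memLp_two_iff_integrable_sq_norm (h3 a)).2 (h4 a)
    simpa only [Function.comp_def, Prod.swap, gradXN_insertNth] using h5

end Gap

/-! ### Kinetic energy, bosonic symmetry and the density matrix -/

section Kinetic

variable {d : ℕ} {Γ : Subgroup (Iso d)} [IsFiniteMeasure (volX Γ)]

/-- The Poincaré inequality in the `i`-th variable. -/
theorem poincare_coreXN (hX : volX Γ ≠ 0) {Ξ : ℝ} (hgap : HasSpectralGap Γ Ξ) {n : ℕ}
    (φ : coreXN Γ (n + 1)) (i : Fin (n + 1)) :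
    Ξ * (‖toL2 (coreXN Γ (n + 1)) (memLp_of_mem_coreXN Γ (n + 1)) φ‖ ^ 2 -
      ‖constPart i (toL2 (coreXN Γ (n + 1)) (memLp_of_mem_coreXN Γ (n + 1)) φ)‖ ^ 2) ≤
      ∑ a, ∫ z, ‖gradXN Γ (i, a) φ z‖ ^ 2 ∂(Measure.pi fun _ => fundVolume Γ) := by
  obtain ⟨-, hφ, hD⟩ := mem_smoothXN_iff.1 φ.2
  have hmp := measurePreserving_insertNth (volX Γ) i
  have hmpν := measurePreserving_insertNth (fundVolume Γ) i
  have hproj := measurePreserving_projN (Γ := Γ) n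
  set G : HypQuot Γ × (Fin n → HypQuot Γ) → ℂ := fun p =>
    (φ : (Fin (n + 1) → HypQuot Γ) → ℂ) (i.insertNth (α := fun _ => HypQuot Γ) p.1 p.2)
  have hG : MemLp G 2 ((volX Γ).prod (volXN Γ n)) := hφ.comp_measurePreserving hmp
  have hGsq := (memLp_two_iff_integrable_sq_norm hG.1).1 hG
  have hc := memLp_partialIntegral hG (memLp_const (μ := volX Γ) (constVal Γ))
  have hcsq := (memLp_two_iff_integrable_sq_norm hc.1).1 hc
  have hE := fun a => (hD (i, a)).comp_measurePreserving hmpν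
  have hEsq := fun a => (memLp_two_iff_integrable_sq_norm (hE a).1).1 (hE a)
  have e1 : ‖toL2 (coreXN Γ (n + 1)) (memLp_of_mem_coreXN Γ (n + 1)) φ‖ ^ 2 =
      ∫ xs, ∫ x, ‖G (x, xs)‖ ^ 2 ∂(volX Γ) ∂(volXN Γ n) := by
    rw [norm_sq_toL2, ← integral_prod_symm _ hGsq]
    exact ((measurePreserving_piFinSuccAbove (fun _ => volX Γ) i).symm.integral_comp' fun x =>
      ‖(φ : (Fin (n + 1) → HypQuot Γ) → ℂ) x‖ ^ 2).symm
  have e2 : ‖constPart i (toL2 (coreXN Γ (n + 1)) (memLp_of_mem_coreXN Γ (n + 1)) φ)‖ ^ 2 =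
      ∫ xs, ‖∫ x, G (x, xs) * constVal Γ ∂(volX Γ)‖ ^ 2 ∂(volXN Γ n) :=
    norm_sq_partialIntegral (coeFn_splitAt i (coeFn_toL2 φ)) coeFn_constState
  have e3 : ∑ a, ∫ z, ‖gradXN Γ (i, a) φ z‖ ^ 2 ∂(Measure.pi fun _ => fundVolume Γ) =
      ∫ zs, ∑ a, ∫ z, ‖gradXN Γ (i, a) φ (i.insertNth (α := fun _ => Hyp d) z zs)‖ ^ 2
        ∂(fundVolume Γ) ∂(Measure.pi fun _ : Fin n => fundVolume Γ) := by
    refine Eq.trans ?_ (integral_finsetSum _ fun a _ => (hEsq a).integral_prod_right).symm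
    refine Finset.sum_congr rfl fun a _ => ?_
    refine Eq.trans ?_ (integral_prod_symm _ (hEsq a))
    exact ((measurePreserving_piFinSuccAbove (fun _ => fundVolume Γ) i).symm.integral_comp' fun z =>
      ‖gradXN Γ (i, a) φ z‖ ^ 2).symm
  -- The left side of the Poincaré inequality for the slice at `xs`. `e4` moves its integral to
  -- `(H^d)^n`, where it can be compared pointwise with the gradient terms.
  set h : (Fin n → HypQuot Γ) → ℝ := fun xs =>
    Ξ * (∫ x, ‖G (x, xs)‖ ^ 2 ∂(volX Γ) - ‖∫ x, G (x, xs) * constVal Γ ∂(volX Γ)‖ ^ 2)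
  have hh : Integrable h (volXN Γ n) := (hGsq.integral_prod_right.sub hcsq).const_mul Ξ
  have e4 : ∫ zs, h (fun j => proj Γ (zs j)) ∂(Measure.pi fun _ : Fin n => fundVolume Γ) =
      ∫ xs, h xs ∂(volXN Γ n) := by
    have hh' := hh.1
    rw [← hproj.map_eq] at hh'
    rw [← integral_map hproj.measurable.aemeasurable hh', hproj.map_eq]
  rw [e1, e2, e3, ← integral_sub hGsq.integral_prod_right hcsq, ← integral_const_mul, ← e4]
  refine integral_mono_ae (hproj.integrable_comp_of_integrable hh)
    (integrable_finsetSum _ fun a _ => (hEsq a).integral_prod_right) ?_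
  filter_upwards [ae_slice_mem_smoothX φ i] with zs hzs
  simp only [gradXN_insertNth]
  exact poincare_smoothX hX hgap hzs

/-- The kinetic energy is bounded below by the number of excited particles. -/
theorem kinetic_lower_bound (hX : volX Γ ≠ 0) {Ξ : ℝ} (hgap : HasSpectralGap Γ Ξ) {n : ℕ}
    {Ψ η : L2XN Γ (n + 1)} (h : (Ψ, η) ∈ laplaceXN Γ (n + 1)) :
    Ξ * ∑ i, (‖Ψ‖ ^ 2 - ‖constPart i Ψ‖ ^ 2) ≤ (inner ℂ Ψ η).re := by
  obtain ⟨φ, hφ, hlim⟩ := exists_seq_of_mem_formOperator (memLp_of_mem_coreXN Γ (n + 1))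
    (energyXN_eq Γ (n + 1)) h
  have hcont : Continuous fun F : L2XN Γ (n + 1) => Ξ * ∑ i, (‖F‖ ^ 2 - ‖constPart i F‖ ^ 2) :=
    continuous_const.mul (continuous_finsetSum _ fun i _ =>
      (continuous_norm.pow 2).sub ((continuous_constPart i).norm.pow 2))
  -- The left side is continuous on `L²`, and the form values of the core sequence converge to `⟨Ψ,
  -- η⟩`.
  refine le_of_tendsto_of_tendsto' ((hcont.tendsto Ψ).comp hφ) hlim fun k => ?_
  rw [gradMapXN, norm_sq_l2Grad, Fintype.sum_prod_type, Function.comp_apply, Finset.mul_sum]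
  exact Finset.sum_le_sum fun i _ => poincare_coreXN hX hgap (φ k) i

theorem coeFn_splitAt_zero {n : ℕ} (Ψ : L2XN Γ (n + 1)) :
    splitAt n 0 Ψ =ᵐ[(volX Γ).prod (volXN Γ n)]
      fun p => Ψ (Fin.cons (α := fun _ => HypQuot Γ) p.1 p.2) := by
  have h := coeFn_splitAt (Ψ := Ψ) 0 (φ := Ψ) EventuallyEq.rfl
  simpa only [Fin.insertNth_zero'] using h

/-- Composition with `i.cycleRange.symm` brings the `i`-th entry to the front and keeps the order of
the others, turning `insertNth` into `cons`. -/
theorem constPart_eq_of_bosonic {n : ℕ} (Ψ : bosonic Γ (n + 1)) (i : Fin (n + 1)) :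
    constPart i (Ψ : L2XN Γ (n + 1)) = constPart 0 (Ψ : L2XN Γ (n + 1)) := by
  have h1 := coeFn_splitAt i (Ψ.2 i.cycleRange.symm).symm
  simp only [Fin.insertNth_comp_cycleRange_symm] at h1
  have h : splitAt n i (Ψ : L2XN Γ (n + 1)) = splitAt n 0 (Ψ : L2XN Γ (n + 1)) :=
    Lp.ext (h1.trans (coeFn_splitAt_zero _).symm)
  simp only [constPart, h]

theorem memLp_cons {n : ℕ} (Ψ : L2XN Γ (n + 1)) :
    MemLp (fun p : HypQuot Γ × (Fin n → HypQuot Γ) =>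
      Ψ (Fin.cons (α := fun _ => HypQuot Γ) p.1 p.2)) 2 ((volX Γ).prod (volXN Γ n)) :=
  (Lp.memLp (splitAt n 0 Ψ)).ae_eq (coeFn_splitAt_zero Ψ)

/-- The one-particle density matrix exists, and its expectation in the constant function is the
squared norm of the component along the constants. -/
theorem exists_isDensityMatrix {n : ℕ} (Ψ : L2XN Γ (n + 1)) :
    ∃ γ : L2X Γ →L[ℂ] L2X Γ, IsDensityMatrix Γ Ψ γ ∧
      inner ℂ (constState Γ) (γ (constState Γ)) = ((‖constPart 0 Ψ‖ ^ 2 : ℝ) : ℂ) := by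
  have hG := memLp_cons Ψ
  have hK := memLp_densityKernel hG
  let K : Lp ℂ 2 ((volX Γ).prod (volX Γ)) := hK.toLp
  have hKK : K =ᵐ[(volX Γ).prod (volX Γ)] fun p => densityKernel Γ Ψ p.2 p.1 := hK.coeFn_toLp
  have hγ : IsDensityMatrix Γ Ψ (partialIntegral (volX Γ) (volX Γ) K) := fun f =>
    coeFn_partialIntegral (f' := f) hKK EventuallyEq.rfl
  refine ⟨_, hγ, ?_⟩
  have e1 : ‖constPart 0 Ψ‖ ^ 2 = ∫ xs, ‖∫ x,
      Ψ (Fin.cons (α := fun _ => HypQuot Γ) x xs) * constVal Γ ∂(volX Γ)‖ ^ 2 ∂(volXN Γ n) := by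
    exact norm_sq_partialIntegral (coeFn_splitAt_zero Ψ) coeFn_constState
  have e2 := inner_partialIntegral_const hKK coeFn_constState
  rw [e2, e1]
  have e3 : conj (constVal Γ) = constVal Γ := Complex.conj_ofReal _
  rw [e3]
  simp only [densityKernel]
  rw [integral_densityKernel hG]
  simp only [integral_mul_const, norm_mul, mul_pow, constVal, Complex.norm_real, Real.norm_eq_abs,
    sq_abs]
  push_cast
  ring

end Kinetic

/-! ### Positivity of the interaction -/

/-- Reverse Cauchy–Schwarz: with `a = z₀` and `b = w₀`, `(ab - 1)² - (a² - 1)(b² - 1) = (a - b)²`.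
It makes distances nonnegative, so `V` is evaluated only where its sign is known. -/
theorem one_le_lorentz {d : ℕ} (z w : Hyp d) : 1 ≤ lorentz z.1 w.1 := by
  have hz := z.2.2
  have hw := w.2.2
  have hz0 := z.2.1
  have hw0 := w.2.1
  simp only [lorentz] at *
  have hcs := Finset.sum_mul_sq_le_sq_mul_sq Finset.univ (fun i : Fin d => z.1 i.succ)
    fun i => w.1 i.succ
  simp only [← pow_two] at *
  set s := ∑ i : Fin d, z.1 i.succ * w.1 i.succ
  have hs : s ^ 2 ≤ (z.1 0 ^ 2 - 1) * (w.1 0 ^ 2 - 1) := by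
    have h1 : ∑ i : Fin d, z.1 i.succ ^ 2 = z.1 0 ^ 2 - 1 := by linarith
    have h2 : ∑ i : Fin d, w.1 i.succ ^ 2 = w.1 0 ^ 2 - 1 := by linarith
    rwa [h1, h2] at hcs
  have hz1 : 1 ≤ z.1 0 ^ 2 := by
    have := Finset.sum_nonneg fun (i : Fin d) (_ : i ∈ Finset.univ) => sq_nonneg (z.1 i.succ)
    linarith
  have hw1 : 1 ≤ w.1 0 ^ 2 := by
    have := Finset.sum_nonneg fun (i : Fin d) (_ : i ∈ Finset.univ) => sq_nonneg (w.1 i.succ)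
    linarith
  have hzw : 1 ≤ z.1 0 * w.1 0 := by nlinarith [mul_pos hz0 hw0]
  have h : s ^ 2 ≤ (z.1 0 * w.1 0 - 1) ^ 2 := by nlinarith [sq_nonneg (z.1 0 - w.1 0)]
  linarith [abs_le_of_sq_le_sq' h (by linarith)]

theorem distX_nonneg {d : ℕ} (Γ : Subgroup (Iso d)) (x x' : HypQuot Γ) : 0 ≤ distX Γ x x' :=
  Real.sInf_nonneg (by
    rintro r ⟨z, w, -, -, rfl⟩
    exact Real.arcosh_nonneg (one_le_lorentz z w))

/-- The energy is at least the kinetic energy. -/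
theorem kinetic_le_of_hamiltonian {d : ℕ} {Γ : Subgroup (Iso d)} [IsFiniteMeasure (volX Γ)] {N : ℕ}
    {μ : ℝ} {V : ℝ → ℝ} (hV : ∀ t, 0 ≤ t → 0 ≤ V t) {Ψ Φ : bosonic Γ N}
    (h : (Ψ, Φ) ∈ hamiltonian Γ N μ V) :
    ∃ η : L2XN Γ N, ((Ψ : L2XN Γ N), η) ∈ laplaceXN Γ N ∧
      μ * (inner ℂ (Ψ : L2XN Γ N) η).re ≤ (inner ℂ (Ψ : L2XN Γ N) (Φ : L2XN Γ N)).re := by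
  obtain ⟨η, hη, hΦ⟩ := h
  refine ⟨η, hη, ?_⟩
  -- `Φ - μη` is the interaction times `Ψ`, so the pairing is the integral of the interaction
  -- against `|Ψ|²`.
  have h0 : 0 ≤ (inner ℂ (Ψ : L2XN Γ N) ((Φ : L2XN Γ N) - (μ : ℂ) • η)).re := by
    have hint := L2.integrable_inner (𝕜 := ℂ) (Ψ : L2XN Γ N) ((Φ : L2XN Γ N) - (μ : ℂ) • η)
    rw [L2.inner_def]
    refine le_of_le_of_eq (integral_nonneg_of_ae ?_) (integral_re hint)
    filter_upwards [Lp.coeFn_sub (Φ : L2XN Γ N) ((μ : ℂ) • η), Lp.coeFn_smul (μ : ℂ) η, hΦ]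
      with x h1 h2 h3
    rw [h1, Pi.sub_apply, h2, h3, Pi.smul_apply, smul_eq_mul, add_sub_cancel_left,
      RCLike.inner_apply, mul_assoc, Complex.mul_conj']
    have hs : 0 ≤ ∑ i : Fin N, ∑ j ∈ Finset.Ioi i, V (distX Γ (x i) (x j)) :=
      Finset.sum_nonneg fun i _ => Finset.sum_nonneg fun j _ => hV _ (distX_nonneg Γ _ _)
    rw [← Complex.ofReal_pow, ← Complex.ofReal_mul]
    exact mul_nonneg hs (sq_nonneg _)
  rw [inner_sub_right, inner_smul_right, Complex.sub_re, Complex.re_ofReal_mul] at h0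
  linarith

end HypBose

end

/-! ### The condensation bound -/

theorem mainTheorem5 (d : ℕ) (hd : 2 ≤ d)
    -- the hyperbolic manifold `X = H^d / Γ`
    (Γ : Subgroup (HypBose.Iso d)) [DiscreteTopology Γ] [IsFiniteMeasure (HypBose.volX Γ)]
    -- the interaction potential
    (V : ℝ → ℝ) (R₀ : ℝ) (hR₀ : 0 < R₀) (hVmeas : Measurable V)
    (hVbdd : MemLp V ⊤ (volume.restrict (Set.Ici 0))) (hVnonneg : ∀ t, 0 ≤ t → 0 ≤ V t)
    (hVsupp : ∀ t, R₀ < t → V t = 0)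
    -- the strength of the kinetic energy and the spectral gap
    (μ : ℝ) (hμ : 0 < μ) (Ξ : ℝ) (hΞ : 0 < Ξ) (hgap : HypBose.HasSpectralGap Γ Ξ)
    -- the ground state of `N = n + 1` particles
    (n : ℕ) (Ψ₀ : HypBose.bosonic Γ (n + 1)) (hΨ₀ : HypBose.IsGroundState Γ (n + 1) μ V Ψ₀) :
    ∃ γ : HypBose.L2X Γ →L[ℂ] HypBose.L2X Γ,
      HypBose.IsDensityMatrix Γ (Ψ₀ : HypBose.L2XN Γ (n + 1)) γ ∧
      1 - HypBose.groundEnergy Γ (n + 1) μ V / (((n + 1 : ℕ) : ℝ) * μ * Ξ) ≤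
        (inner ℂ (HypBose.constState Γ) (γ (HypBose.constState Γ))).re := by
  obtain ⟨hnorm, hH⟩ := hΨ₀
  have hnorm' : ‖(Ψ₀ : HypBose.L2XN Γ (n + 1))‖ = 1 := hnorm
  -- The case `vol X = 0` is excluded by `‖Ψ₀‖ = 1`, since then `L²(X^N) = 0`.
  have hX : HypBose.volX Γ ≠ 0 := by
    intro h0
    have hN : HypBose.volXN Γ (n + 1) = 0 := by
      rw [← Measure.measure_univ_eq_zero, HypBose.volXN, Measure.pi_univ]
      simp [h0]
    have : (Ψ₀ : HypBose.L2XN Γ (n + 1)) = 0 := 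
      Lp.ext (Eventually.filter_mono (ae_eq_bot.2 hN).le eventually_bot)
    rw [this, norm_zero] at hnorm'
    exact zero_ne_one hnorm'
  obtain ⟨γ, hγ, hval⟩ := HypBose.exists_isDensityMatrix (Ψ₀ : HypBose.L2XN Γ (n + 1))
  refine ⟨γ, hγ, ?_⟩
  obtain ⟨η, hη, hle⟩ := HypBose.kinetic_le_of_hamiltonian hVnonneg hH
  have hkin := HypBose.kinetic_lower_bound hX hgap hη
  -- By symmetry the sum over particles is `n + 1` times `1 - ‖constPart 0 Ψ₀‖²`.
  simp only [HypBose.constPart_eq_of_bosonic, hnorm', Finset.sum_const, Finset.card_univ,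
    Fintype.card_fin, nsmul_eq_mul] at hkin
  have hE : (inner ℂ (Ψ₀ : HypBose.L2XN Γ (n + 1))
      (((HypBose.groundEnergy Γ (n + 1) μ V : ℂ) • Ψ₀ : HypBose.bosonic Γ (n + 1)) :
        HypBose.L2XN Γ (n + 1))).re = HypBose.groundEnergy Γ (n + 1) μ V := by
    rw [Submodule.coe_smul, inner_smul_right, inner_self_eq_one_of_norm_eq_one hnorm', mul_one,
      Complex.ofReal_re]
  rw [hE] at hle
  rw [hval, Complex.ofReal_re, sub_le_comm, le_div_iff₀ (by positivity)]
  have := mul_le_mul_of_nonneg_left hkin hμ.le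
  linarith
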